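/- **Setting.** Let $n\ge 1$. The partition monoid $\mathcal P_n$ consists of the set partitions of $\{1,\dots,n\}\cup\{1',\dots,n'\}$. For $\alpha,\beta\in\mathcal P_n$ let $\Gamma(\alpha,\beta)$ be the graph on $\{1,\dots,n\}\cup\{1'',\dots,n''\}\cup\{1',\dots,n'\}$ obtained by drawing $\alpha$ on the first two rows and $\beta$ on the last two; two outer vertices lie in the same block of $\alpha\beta$ iff they are connected in $\Gamma(\alpha,\beta)$, and $\Phi(\alpha,\beta)$ is the number of components of $\Gamma(\alpha,\beta)$ contained in the middle row. The twisted partition monoid is $\mathcal P_n^\Phi=\mathbb N\times\mathcal P_n$ with $(i,\alpha)(j,\beta)=(i+j+\Phi(\alpha,\beta),\alpha\beta)$. A transversal of $\alpha$ is a block meeting both rows; $\operatorname{rank}\alpha$ is the number of transversals; $\widehat\alpha$ is obtained from $\alpha$ by splitting each transversal into its upper and lower part. $\mathscr R,\mathscr L,\mathscr H$ are Green's relations of $\mathcal P_n$. If $\alpha\mathrel{\mathscr H}\beta$ have transversals $A_s\cup B_s'$ and $A_s\cup B_{s\pi}'$ ($1\le s\le q$), put $\operatorname{pd}(\alpha,\beta)=\pi\in\mathcal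 S_q$ (well defined up to conjugacy). Write $(m,m+d)^\sharp=\Delta_{\mathbb N}\cup\{(i,j): i,j\ge m,\ i\equiv j \bmod d\}$ ($m\ge0$, $d\ge1$) for the non-trivial congruences $\theta$ of $(\mathbb N,+)$, with $\min\theta=m$, $\operatorname{per}\theta=d$; put $\min\Delta_{\mathbb N}=\operatorname{per}\Delta_{\mathbb N}=\infty$. Every element of $\mathbb N\cup\{\infty\}$ divides $\infty$. **C-pairs.** A C-pair $\Pi=(\Theta,M)$ consists of congruences $\theta_0\supseteq\dots\supseteq\theta_n$ of $\mathbb N$ and a matrix $M=(M_{qi})_{0\le q\le n,\,i\in\mathbb N}$ with entries from $\Delta,\mu^\uparrow,\mu^\downarrow,\mu,\lambda,\rho,R$ and the $N$-symbols $N$ ($\{\mathrm{id}\}\ne N\trianglelefteq\mathcal S_q$, $2\le q\le n$), as follows. Below, $\zeta\in\{\mu,\mu^\uparrow,\mu^\downarrow,\Delta\}$, and $\xi\in\{\mu,\rho,\lambda,R\}$ if $d=1$, $\xi=\mu$ if $d>1$. Rows $0$ and $1$ are of one of the types: * RT1: all entries $\Delta$. * RT2: $\theta_0=\theta_1=\Delta_{\mathbb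 N}$; for some $i\ge0$, $M_{0j}=\Delta$ ($j<i$), $\mu$ ($j\ge i$); $M_{1j}=\Delta$ ($j<i$), $\zeta$ ($j=i$), $\mu$ ($j>i$). * RT3: $\theta_0=(m,m+1)^\sharp$; $M_{0j}=\Delta$ ($j<m$), $\xi'$ ($j\ge m$), with $\xi'\in\{\rho,\lambda,R\}$; row 1 all $\Delta$. * RT4: $\theta_0=\theta_1=(m,m+d)^\sharp$; $M_{0j}=M_{1j}=\Delta$ ($j<m$), $\xi$ ($j\ge m$). * RT5: $\theta_0=(m,m+d)^\sharp$, $\theta_1=(m+1,m+1+d)^\sharp$; for some $0\le i<m$, $M_{0j}=\Delta$ ($j<i$), $\mu$ ($i\le j<m$), $\xi$ ($j\ge m$); $M_{1j}=\Delta$ ($j<i$), $\zeta$ ($j=i$), $\mu$ ($i<j\le m$), $\xi$ ($j>m$). * RT6: $\theta_0=(m,m+d)^\sharp$, $\theta_1=(l,l+d)^\sharp$, $l>m$; $M_{0j}=\Delta$ ($j<m$), $\xi$ ($j\ge m$); $M_{1j}=\Delta$ ($j<l-1$), $\zeta$ ($j=l-1$), $\xi$ ($j\ge l$). * RT7: $\theta_0=(m,m+d)^\sharp$,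 $\theta_1=(l,l+d)^\sharp$, $l-1>m>0$, $l-1\equiv m\bmod d$; $M_{0j}=\Delta$ ($j<m-1$), $\mu$ ($j=m-1$), $\xi$ ($j\ge m$); $M_{1j}=\Delta$ ($j<l-1$), $\mu$ ($j=l-1$), $\xi$ ($j\ge l$). Each row $q\ge2$ is of one of the types: * RT8: all entries $\Delta$. * RT9: $\Delta,\dots,\Delta,N_i,\dots,N_{k-1},N,N,\dots$ with $0\le i\le k\le\min\theta_q$, $k<\infty$, the first $N$ in position $k$, and $N_i\le\dots\le N_{k-1}\le N$ non-trivial normal subgroups of $\mathcal S_q$. * RT10: $\theta_q=(m,m+1)^\sharp$ and the row is $\Delta,\dots,\Delta,N_i,\dots,N_{m-1},R,R,\dots$ with $0\le i\le m$, the first $R$ in position $m$, and $N_i\le\dots\le N_{m-1}$ non-trivial normal subgroups of $\mathcal S_q$. Moreover an $N$-symbol is never immediately above $\Delta,\mu^\uparrow,\mu^\downarrow$ or an $N$-symbol, and every $R$ in a row $q\ge2$ is immediately above an $R$. **Relations.** $\mathrm{cg}(\Pi)$ is the set of pairs $((i,\alpha),(j,\beta))$ such that, with $q=\operatorname{rank}\alpha$,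 $r=\operatorname{rank}\beta$, the entries $M_{qi}=M_{rj}=:s$ are equal and: if $s=\Delta$: $(i,j)\in\theta_q$, $\alpha=\beta$; if $s=R$: no condition; if $s=N$: $(i,j)\in\theta_q$, $\alpha\mathrel{\mathscr H}\beta$, $\operatorname{pd}(\alpha,\beta)\in N$; if $s=\lambda$: $\widehat\alpha\mathrel{\mathscr L}\widehat\beta$; if $s=\rho$: $\widehat\alpha\mathrel{\mathscr R}\widehat\beta$; if $s=\mu^\downarrow$: $\widehat\alpha=\widehat\beta$, $\alpha\mathrel{\mathscr L}\beta$; if $s=\mu^\uparrow$: $\widehat\alpha=\widehat\beta$, $\alpha\mathrel{\mathscr R}\beta$; if $s=\mu$: $\widehat\alpha=\widehat\beta$ and either $q=r$ and $(i,j)\in\theta_q$, or $q\ne r$, $(i+r,j+q)\in\theta_0$ and [$i<\min\theta_q$ and $j<\min\theta_r$, or $i\ge\min\theta_q$ and $j\ge\min\theta_r$]. $\Pi$ is *exceptional* if for some $q\ge2$: $\theta_q=(m,m+2d)^\sharp$ with $m\ge0$, $d\ge1$; if $q>2$ then $M_{qm}=\mathcal A_q$; if $q=2$ then $M_{2m}=\Delta$,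 $M_{1m}\in\{\mu,\rho,\lambda,R\}$ and $(m,m+d)^\sharp\subseteq\theta_1$. This $q=:\mathsf x(M)$ is unique. Then $\mathrm{cgx}(\Pi)$ consists of $\mathrm{cg}(\Pi)$ together with all pairs $((i,\alpha),(j,\beta))$ with $\operatorname{rank}\alpha=\operatorname{rank}\beta=q$, $(i,j)\in(m,m+d)^\sharp\setminus\theta_q$, $\alpha\mathrel{\mathscr H}\beta$ and $\operatorname{pd}(\alpha,\beta)\in\mathcal S_q\setminus\mathcal A_q$. **Order.** Symbols are partially ordered by: $\Delta$ is least, $R$ is greatest, $\mu^\uparrow,\mu^\downarrow<\mu<\lambda,\rho$, and $N$-symbols for the same $\mathcal S_q$ are ordered by inclusion; there are no other relations. $\Pi^1\le_C\Pi^2$ means $\theta^1_q\subseteq\theta^2_q$ and $M^1_{qi}\le M^2_{qi}$ for all $q,i$. If $M$ has type RT2 or RT5 put $\mu\mathrm{in}_0(M)=i$, $\mu\mathrm{in}_1(M)=i+1$; if it has type RT7 put $\mu\mathrm{in}_0(M)=m-1$, $\mu\mathrm{in}_1(M)=l-1$. For $n=1$, call $\Pi$ *reduced* if $M$ has entries in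 $\{\Delta,\mu,R\}$ only; whenever $M_{1i}=\mu$ with $i<\min\theta_1$ there is $j<\min\theta_0$ with $M_{0j}=\mu$ and $(i,j+1)\in\theta_0$; and if $\operatorname{per}\theta_0=1$ then $M_{0i}=R$ for all $i\ge\min\theta_0$. **Theorem.** Let $n\ge1$ and let $\Pi^1=(\Theta^1,M^1)$, $\Pi^2=(\Theta^2,M^2)$ be C-pairs for $\mathcal P_n^\Phi$. (i) Consider the conditions (a) $\Pi^1\le_C\Pi^2$; (b) if $M^1$ has type RT2, RT5 or RT7, then at least one of the following holds: (b1) $\min\theta_0^2\le\mu\mathrm{in}_0(M^1)$ and $\min\theta_1^2\le\mu\mathrm{in}_1(M^1)$; (b2) $M^2$ also has type RT2, RT5 or RT7 (not necessarily the same as $M^1$) and $\mu\mathrm{in}_1(M^2)-\mu\mathrm{in}_0(M^2)=\mu\mathrm{in}_1(M^1)-\mu\mathrm{in}_0(M^1)$. If (a) and (b) hold, then $\mathrm{cg}(\Pi^1)\subseteq\mathrm{cg}(\Pi^2)$. Conversely, if $\mathrm{cg}(\Pi^1)\subseteq\mathrm{cg}(\Pi^2)$, and in case $n=1$ both C-pairs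 are reduced, then (a) and (b) hold. (ii) If $\Pi^2$ is exceptional, then $\mathrm{cg}(\Pi^1)\subseteq\mathrm{cgx}(\Pi^2)$ if and only if $\mathrm{cg}(\Pi^1)\subseteq\mathrm{cg}(\Pi^2)$. (iii) If $\Pi^1$ is exceptional and $q=\mathsf x(M^1)$, then $\mathrm{cgx}(\Pi^1)\subseteq\mathrm{cg}(\Pi^2)$ if and only if $\mathrm{cg}(\Pi^1)\subseteq\mathrm{cg}(\Pi^2)$, $2\operatorname{per}\theta_q^2\mid\operatorname{per}\theta_q^1$, and $M^2_{qi}\in\{\mathcal S_q,R\}$ for all $i\ge\min\theta_q^2$. (iv) If both are exceptional, then $\mathrm{cgx}(\Pi^1)\subseteq\mathrm{cgx}(\Pi^2)$ if and only if $\mathrm{cg}(\Pi^1)\subseteq\mathrm{cg}(\Pi^2)$ and, in case $\mathsf x(M^1)=\mathsf x(M^2)=:q$, the ratio $\operatorname{per}\theta_q^1/\operatorname{per}\theta_q^2$ is an odd integer. -/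

import Mathlib

/-! ### The partition monoid -/

/-- A partition of the set `{1,…,n} ∪ {1',…,n'}`, encoded by the equivalence relation whose
classes are its blocks. `Sum.inl x` is the upper vertex `x`, `Sum.inr x` the lower vertex `x'`. -/
@[ext]
structure Partn (n : ℕ) where
  /-- the equivalence relation "lying in the same block" -/
  rel : Setoid (Fin n ⊕ Fin n)

namespace Partn

variable {n : ℕ}

/-- The connected components of the product graph of `α` and `β`, as an equivalence relation on
upper, middle and lower vertices (`inl x`, `inr (inl x)`, `inr (inr x)` respectively): the
equivalence generated by `α` drawn on the upper and middle rows together with `β` drawn on the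
middle and lower rows. -/
def prodGraph (α β : Partn n) : Setoid (Fin n ⊕ (Fin n ⊕ Fin n)) :=
  Relation.EqvGen.setoid fun x y =>
    (∃ a b, α.rel a b ∧ x = Sum.map id Sum.inl a ∧ y = Sum.map id Sum.inl b) ∨
    (∃ a b, β.rel a b ∧ x = Sum.inr a ∧ y = Sum.inr b)

/-- The product of partitions: two outer vertices are in the same block iff they are in the same
connected component of the product graph. -/
instance : Mul (Partn n) where
  mul α β := ⟨Setoid.comap (Sum.map id Sum.inr) (prodGraph α β)⟩

/-- The identity partition, with blocks `{x, x'}`. -/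
instance : One (Partn n) where
  one := ⟨Setoid.ker (Sum.elim id id)⟩

/-- The number of floating components: components of the product graph all of whose vertices
are in the middle row. -/
noncomputable def floating (α β : Partn n) : ℕ :=
  Set.ncard {C | C ∈ (prodGraph α β).classes ∧ C ⊆ Set.range (fun x => Sum.inr (Sum.inl x))}

/-- The set of transversals: blocks containing both upper and lower vertices. -/
def transversals (α : Partn n) : Set (Set (Fin n ⊕ Fin n)) :=
  {C | C ∈ α.rel.classes ∧ (∃ x, Sum.inl x ∈ C) ∧ ∃ y, Sum.inr y ∈ C}

/-- The rank: the number of transversals. -/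
noncomputable def rank (α : Partn n) : ℕ := α.transversals.ncard

/-- The partition `α̂` obtained by breaking every transversal into its upper and lower part. -/
def hat (α : Partn n) : Partn n where
  rel :=
    { r := fun x y => α.rel x y ∧ x.isLeft = y.isLeft
      iseqv :=
        { refl := fun x => ⟨α.rel.refl x, rfl⟩
          symm := fun h => ⟨α.rel.symm h.1, h.2.symm⟩
          trans := fun h k => ⟨α.rel.trans h.1 k.1, h.2.trans k.2⟩ } }

/-- `PermDiff α β π`: the transversals of `α` can be listed as `A₁ ∪ B₁', …, A_q ∪ B_q'` in such a
way that those of `β` are `A_i ∪ B_{iπ}'`, while `α` and `β` have the same other blocks; that is,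
`π` is a value (for some labelling) of the permutational difference of `α` and `β`. Changing the
labelling replaces `π` by a conjugate. -/
def PermDiff {q : ℕ} (α β : Partn n) (π : Equiv.Perm (Fin q)) : Prop :=
  ∃ A B : Fin q → Set (Fin n),
    Function.Injective (fun i => Sum.inl '' A i ∪ Sum.inr '' B i) ∧
    α.transversals = Set.range (fun i => Sum.inl '' A i ∪ Sum.inr '' B i) ∧
    β.transversals = Set.range (fun i => Sum.inl '' A i ∪ Sum.inr '' B (π i)) ∧
    α.rel.classes \ α.transversals = β.rel.classes \ β.transversals

end Partn

/-- Green's relation R: equality of principal right ideals `xM = yM`. -/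
def GreenR {M : Type*} [Mul M] (x y : M) : Prop :=
  Set.range (fun z => x * z) = Set.range (fun z => y * z)

/-- Green's relation L: equality of principal left ideals `Mx = My`. -/
def GreenL {M : Type*} [Mul M] (x y : M) : Prop :=
  Set.range (fun z => z * x) = Set.range (fun z => z * y)

/-- Green's relation H. -/
def GreenH {M : Type*} [Mul M] (x y : M) : Prop := GreenR x y ∧ GreenL x y

/-- The twisted partition monoid: pairs `(i, α)` of a natural number and a partition. -/
structure TwistedPartn (n : ℕ) where
  /-- the number of floating components -/
  fl : ℕ
  /-- the underlying partition -/
  part : Partn n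

/-- `(i, α)(j, β) = (i + j + Φ(α, β), αβ)`. -/
noncomputable instance {n : ℕ} : Mul (TwistedPartn n) where
  mul a b := ⟨a.fl + b.fl + Partn.floating a.part b.part, a.part * b.part⟩

/-! ### Congruences on the additive monoid of natural numbers -/

/-- The congruence `(m, m+d)♯ = Δ ∪ {(i,j) : i, j ≥ m, i ≡ j mod d}` on `ℕ`. -/
def natCon (m d : ℕ) : AddCon ℕ where
  r i j := i = j ∨ (m ≤ i ∧ m ≤ j ∧ i ≡ j [MOD d])
  iseqv :=
    { refl := fun _ => Or.inl rfl
      symm := by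
        rintro i j (h | ⟨h1, h2, h3⟩)
        · exact Or.inl h.symm
        · exact Or.inr ⟨h2, h1, h3.symm⟩
      trans := by
        rintro i j k (rfl | ⟨h1, h2, h3⟩) (rfl | ⟨k1, k2, k3⟩)
        · exact Or.inl rfl
        · exact Or.inr ⟨k1, k2, k3⟩
        · exact Or.inr ⟨h1, h2, h3⟩
        · exact Or.inr ⟨h1, k2, h3.trans k3⟩ }
  add' := by
    rintro i j k l (rfl | ⟨h1, h2, h3⟩) (rfl | ⟨k1, k2, k3⟩)
    · exact Or.inl rfl
    · exact Or.inr ⟨by omega, by omega, k3.add_left i⟩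
    · exact Or.inr ⟨by omega, by omega, h3.add_right k⟩
    · exact Or.inr ⟨by omega, by omega, h3.add k3⟩

/-- The minimum of a congruence on `ℕ`: the least number related to a different number
(`m` for `(m, m+d)♯` with `d ≥ 1`, and `∞` for the trivial congruence). -/
noncomputable def conMin (θ : AddCon ℕ) : ℕ∞ :=
  sInf {x : ℕ∞ | ∃ i j : ℕ, i ≠ j ∧ θ i j ∧ x = i}

/-- The period of a congruence on `ℕ`: the least positive difference of related numbers
(`d` for `(m, m+d)♯` with `d ≥ 1`, and `∞` for the trivial congruence). -/
noncomputable def conPer (θ : AddCon ℕ) : ℕ∞ :=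
  sInf {x : ℕ∞ | ∃ i d : ℕ, 1 ≤ d ∧ θ i (i + d) ∧ x = d}

/-! ### Matrix entries -/

/-- The symbols allowed in a C-matrix: `Δ, μ↑, μ↓, μ, λ, ρ, R` and the `N`-symbols, where
`N q H` stands for the subgroup `H` of the symmetric group on `q` points (that `H` is normal and
non-trivial, and that `q` is the index of the row, is imposed by the row types). -/
inductive Entry : Type
  | delta : Entry
  | muUp : Entry
  | muDown : Entry
  | mu : Entry
  | lam : Entry
  | rho : Entry
  | R : Entry
  | N (q : ℕ) (H : Subgroup (Equiv.Perm (Fin q))) : Entry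

namespace Entry

/-- Being an `N`-symbol. -/
def IsN (x : Entry) : Prop := ∃ q H, x = N q H

/-- The order on symbols: `Δ` is the bottom, `R` is the top, `μ↑` and `μ↓` are below `μ`, which is
below `λ` and `ρ`, and the `N`-symbols for the same symmetric group are ordered by inclusion. -/
inductive LEC : Entry → Entry → Prop
  | refl (x : Entry) : LEC x x
  | bot (x : Entry) : LEC delta x
  | top (x : Entry) : LEC x R
  | muUp_mu : LEC muUp mu
  | muUp_lam : LEC muUp lam
  | muUp_rho : LEC muUp rho
  | muDown_mu : LEC muDown mu
  | muDown_lam : LEC muDown lam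
  | muDown_rho : LEC muDown rho
  | mu_lam : LEC mu lam
  | mu_rho : LEC mu rho
  | N {q : ℕ} {H K : Subgroup (Equiv.Perm (Fin q))} (h : H ≤ K) : LEC (N q H) (N q K)

end Entry

/-! ### Row types -/

/-- Type 1 of rows 0 and 1: `Δ`s only. -/
def RT1 (r₀ r₁ : ℕ → Entry) : Prop :=
  ∀ j, r₀ j = .delta ∧ r₁ j = .delta

/-- The symbols allowed for `ζ`. -/
def IsZeta (ζ : Entry) : Prop := ζ = .mu ∨ ζ = .muUp ∨ ζ = .muDown ∨ ζ = .delta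

/-- The symbols allowed for `ξ` when the period is `d`: any of `μ, ρ, λ, R` if `d = 1`, and only
`μ` if `d > 1`. -/
def IsXi (d : ℕ) (ξ : Entry) : Prop :=
  ξ = .mu ∨ (d = 1 ∧ (ξ = .rho ∨ ξ = .lam ∨ ξ = .R))

/-- Type 2 of rows 0 and 1. -/
def RT2 (θ₀ θ₁ : AddCon ℕ) (r₀ r₁ : ℕ → Entry) (i : ℕ) : Prop :=
  θ₀ = ⊥ ∧ θ₁ = ⊥ ∧ ∃ ζ, IsZeta ζ ∧
    (∀ j, r₀ j = if j < i then .delta else .mu) ∧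
    (∀ j, r₁ j = if j < i then .delta else if j = i then ζ else .mu)

/-- Type 3 of rows 0 and 1. -/
def RT3 (θ₀ : AddCon ℕ) (r₀ r₁ : ℕ → Entry) (m : ℕ) : Prop :=
  θ₀ = natCon m 1 ∧ ∃ ξ, (ξ = .rho ∨ ξ = .lam ∨ ξ = .R) ∧
    (∀ j, r₀ j = if j < m then .delta else ξ) ∧
    (∀ j, r₁ j = .delta)

/-- Type 4 of rows 0 and 1. -/
def RT4 (θ₀ θ₁ : AddCon ℕ) (r₀ r₁ : ℕ → Entry) (m d : ℕ) : Prop :=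
  1 ≤ d ∧ θ₀ = natCon m d ∧ θ₁ = natCon m d ∧ ∃ ξ, IsXi d ξ ∧
    (∀ j, r₀ j = if j < m then .delta else ξ) ∧
    (∀ j, r₁ j = if j < m then .delta else ξ)

/-- Type 5 of rows 0 and 1. -/
def RT5 (θ₀ θ₁ : AddCon ℕ) (r₀ r₁ : ℕ → Entry) (i m d : ℕ) : Prop :=
  1 ≤ d ∧ θ₀ = natCon m d ∧ θ₁ = natCon (m + 1) d ∧ i < m ∧
  ∃ ζ ξ, IsZeta ζ ∧ IsXi d ξ ∧
    (∀ j, r₀ j = if j < i then .delta else if j < m then .mu else ξ) ∧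
    (∀ j, r₁ j = if j < i then .delta else if j = i then ζ else if j < m + 1 then .mu else ξ)

/-- Type 6 of rows 0 and 1. -/
def RT6 (θ₀ θ₁ : AddCon ℕ) (r₀ r₁ : ℕ → Entry) (m l d : ℕ) : Prop :=
  1 ≤ d ∧ θ₀ = natCon m d ∧ θ₁ = natCon l d ∧ m < l ∧
  ∃ ζ ξ, IsZeta ζ ∧ IsXi d ξ ∧
    (∀ j, r₀ j = if j < m then .delta else ξ) ∧
    (∀ j, r₁ j = if j + 1 < l then .delta else if j + 1 = l then ζ else ξ)

/-- Type 7 of rows 0 and 1; the congruence condition is `l - 1 ≡ m (mod d)`. -/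
def RT7 (θ₀ θ₁ : AddCon ℕ) (r₀ r₁ : ℕ → Entry) (m l d : ℕ) : Prop :=
  1 ≤ d ∧ θ₀ = natCon m d ∧ θ₁ = natCon l d ∧ 0 < m ∧ m < l - 1 ∧ l - 1 ≡ m [MOD d] ∧
  ∃ ξ, IsXi d ξ ∧
    (∀ j, r₀ j = if j + 1 < m then .delta else if j + 1 = m then .mu else ξ) ∧
    (∀ j, r₁ j = if j + 1 < l then .delta else if j + 1 = l then .mu else ξ)

/-- Type 8, of a row `q ≥ 2`: `Δ`s only. -/
def RT8 (r : ℕ → Entry) : Prop := ∀ j, r j = .delta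

/-- Type 9, of a row `q ≥ 2`: `Δ, …, Δ, N_i, …, N_{k-1}, N, N, …` with
`i ≤ k ≤ min θ_q` and an ascending sequence of non-trivial normal subgroups. -/
def RT9 (q : ℕ) (θ : AddCon ℕ) (r : ℕ → Entry) : Prop :=
  ∃ (i k : ℕ) (H : ℕ → Subgroup (Equiv.Perm (Fin q))),
    i ≤ k ∧ (k : ℕ∞) ≤ conMin θ ∧
    (∀ j, i ≤ j → (H j).Normal ∧ H j ≠ ⊥ ∧ H j ≤ H (j + 1)) ∧
    (∀ j, k ≤ j → H j = H k) ∧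
    (∀ j, r j = if j < i then .delta else .N q (H j))

/-- Type 10, of a row `q ≥ 2`: `Δ, …, Δ, N_i, …, N_{m-1}, R, R, …` with `i ≤ m`,
`θ_q = (m, m+1)♯` and an ascending sequence of non-trivial normal subgroups. -/
def RT10 (q : ℕ) (θ : AddCon ℕ) (r : ℕ → Entry) : Prop :=
  ∃ (i m : ℕ) (H : ℕ → Subgroup (Equiv.Perm (Fin q))),
    i ≤ m ∧ θ = natCon m 1 ∧
    (∀ j, i ≤ j → j < m → (H j).Normal ∧ H j ≠ ⊥) ∧
    (∀ j, i ≤ j → j + 1 < m → H j ≤ H (j + 1)) ∧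
    (∀ j, r j = if j < i then .delta else if j < m then .N q (H j) else .R)

/-! ### C-pairs -/

/-- A C-pair `(Θ, M)` for the twisted partition monoid of degree `n`. Only the rows `0, …, n` of
`θ` and `M` carry information: the remaining rows are never referred to. -/
structure CPair (n : ℕ) where
  /-- the C-chain -/
  θ : ℕ → AddCon ℕ
  /-- the C-matrix -/
  M : ℕ → ℕ → Entry
  chain : ∀ q, q < n → θ (q + 1) ≤ θ q
  lowRows :
    RT1 (M 0) (M 1) ∨
    (∃ i, RT2 (θ 0) (θ 1) (M 0) (M 1) i) ∨
    (∃ m, RT3 (θ 0) (M 0) (M 1) m) ∨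
    (∃ m d, RT4 (θ 0) (θ 1) (M 0) (M 1) m d) ∨
    (∃ i m d, RT5 (θ 0) (θ 1) (M 0) (M 1) i m d) ∨
    (∃ m l d, RT6 (θ 0) (θ 1) (M 0) (M 1) m l d) ∨
    (∃ m l d, RT7 (θ 0) (θ 1) (M 0) (M 1) m l d)
  highRows : ∀ q, 2 ≤ q → q ≤ n → RT8 (M q) ∨ RT9 q (θ q) (M q) ∨ RT10 q (θ q) (M q)
  /-- An `N`-symbol is never immediately above `Δ`, `μ↑`, `μ↓` or another `N`-symbol. -/
  vert1 : ∀ q i, q + 1 ≤ n → (M (q + 1) i).IsN →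
    M q i ≠ .delta ∧ M q i ≠ .muUp ∧ M q i ≠ .muDown ∧ ¬ (M q i).IsN
  /-- Every `R` in a row `≥ 2` is directly above an `R`. -/
  vert2 : ∀ q i, 2 ≤ q + 1 → q + 1 ≤ n → M (q + 1) i = .R → M q i = .R

namespace CPair

variable {n : ℕ}

/-- The order on C-pairs: componentwise inclusion of the congruences on `ℕ` and entrywise
comparison of the matrices. -/
def LEC (P Q : CPair n) : Prop :=
  (∀ q, q ≤ n → P.θ q ≤ Q.θ q) ∧ ∀ q, q ≤ n → ∀ i, Entry.LEC (P.M q i) (Q.M q i)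

/-- The relation `cg(Θ, M)` on the twisted partition monoid. -/
def cg (P : CPair n) : Set (TwistedPartn n × TwistedPartn n) :=
  {p | ∃ (i j : ℕ) (α β : Partn n) (q r : ℕ),
    p = (⟨i, α⟩, ⟨j, β⟩) ∧ q = α.rank ∧ r = β.rank ∧
    ( -- entries `Δ`
      (P.M q i = .delta ∧ P.M r j = .delta ∧ P.θ q i j ∧ α = β) ∨
      -- entries `R`
      (P.M q i = .R ∧ P.M r j = .R) ∨
      -- entries an `N`-symbol
      (∃ H : Subgroup (Equiv.Perm (Fin q)), P.M q i = .N q H ∧ P.M r j = .N q H ∧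
        P.θ q i j ∧ GreenH α β ∧ ∃ π ∈ H, Partn.PermDiff α β π) ∨
      -- entries `λ`
      (P.M q i = .lam ∧ P.M r j = .lam ∧ GreenL α.hat β.hat) ∨
      -- entries `ρ`
      (P.M q i = .rho ∧ P.M r j = .rho ∧ GreenR α.hat β.hat) ∨
      -- entries `μ↓`
      (P.M q i = .muDown ∧ P.M r j = .muDown ∧ α.hat = β.hat ∧ GreenL α β) ∨
      -- entries `μ↑`
      (P.M q i = .muUp ∧ P.M r j = .muUp ∧ α.hat = β.hat ∧ GreenR α β) ∨
      -- entries `μ`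
      (P.M q i = .mu ∧ P.M r j = .mu ∧ α.hat = β.hat ∧
        ((q = r ∧ P.θ q i j) ∨
         (q ≠ r ∧ P.θ 0 (i + r) (j + q) ∧ (i : ℕ∞) < conMin (P.θ q) ∧ (j : ℕ∞) < conMin (P.θ r)) ∨
         (q ≠ r ∧ P.θ 0 (i + r) (j + q) ∧
           conMin (P.θ q) ≤ (i : ℕ∞) ∧ conMin (P.θ r) ≤ (j : ℕ∞))))) }

/-- `P.ExcRow q m d`: the C-pair `P` is exceptional, with exceptional row `q` and with
`θ_q = (m, m+2d)♯`. -/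
def ExcRow (P : CPair n) (q m d : ℕ) : Prop :=
  2 ≤ q ∧ q ≤ n ∧ 1 ≤ d ∧ P.θ q = natCon m (2 * d) ∧
  (2 < q → P.M q m = .N q (alternatingGroup (Fin q))) ∧
  (q = 2 → P.M 2 m = .delta ∧
    (P.M 1 m = .mu ∨ P.M 1 m = .rho ∨ P.M 1 m = .lam ∨ P.M 1 m = .R) ∧
    natCon m d ≤ P.θ 1)

/-- `P` is exceptional with exceptional row `q`, i.e. `q = x(M)`. -/
def IsExceptional (P : CPair n) (q : ℕ) : Prop := ∃ m d, P.ExcRow q m d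

/-- The relation `cgx(Θ, M)`: the pairs of `cg(Θ, M)` and the pairs `((i,α),(j,β))` with `α`, `β`
in the exceptional row `q`, `(i,j) ∈ (m, m+d)♯ \ (m, m+2d)♯`, and `α`, `β` being H-related with
odd permutational difference. -/
def cgx (P : CPair n) : Set (TwistedPartn n × TwistedPartn n) :=
  P.cg ∪ {p | ∃ (i j : ℕ) (α β : Partn n) (q m d : ℕ),
    p = (⟨i, α⟩, ⟨j, β⟩) ∧ P.ExcRow q m d ∧ q = α.rank ∧ q = β.rank ∧
    natCon m d i j ∧ ¬ P.θ q i j ∧ GreenH α β ∧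
    ∃ π : Equiv.Perm (Fin q), π ∉ alternatingGroup (Fin q) ∧ Partn.PermDiff α β π}

/-- `P.MuIn a b`: the matrix has type 2, 5 or 7, the first initial `μ` of row 0 is in position `a`
and its matching `μ` in row 1 is in position `b`. -/
def MuIn (P : CPair n) (a b : ℕ) : Prop :=
  (RT2 (P.θ 0) (P.θ 1) (P.M 0) (P.M 1) a ∧ b = a + 1) ∨
  (∃ m d, RT5 (P.θ 0) (P.θ 1) (P.M 0) (P.M 1) a m d ∧ b = a + 1) ∨
  (∃ m l d, RT7 (P.θ 0) (P.θ 1) (P.M 0) (P.M 1) m l d ∧ a = m - 1 ∧ b = l - 1)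

/-- Normal form of C-pairs in the degenerate degree `n = 1`, where `μ↑`, `μ↓` play the same role as
`Δ`, and `λ`, `ρ` the same role as `R`: only `Δ`, `μ` and `R` are used, there are no unmatched
`μ`s in row 1, and if `θ₀` has period 1 then row 0 consists of `R`s from position `min θ₀` on. -/
def Reduced (P : CPair n) : Prop :=
  (∀ q i, q ≤ 1 → P.M q i = .delta ∨ P.M q i = .mu ∨ P.M q i = .R) ∧
  (∀ i : ℕ, P.M 1 i = .mu → (i : ℕ∞) < conMin (P.θ 1) →
    ∃ j : ℕ, P.M 0 j = .mu ∧ (j : ℕ∞) < conMin (P.θ 0) ∧ P.θ 0 i (j + 1)) ∧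
  (conPer (P.θ 0) = 1 → ∀ i : ℕ, conMin (P.θ 0) ≤ (i : ℕ∞) → P.M 0 i = .R)

/-- The combinatorial comparison of C-pairs describing inclusion of the congruences `cg`. -/
def Compares (P Q : CPair n) : Prop :=
  P.LEC Q ∧
  ∀ a b, P.MuIn a b →
    (conMin (Q.θ 0) ≤ (a : ℕ∞) ∧ conMin (Q.θ 1) ≤ (b : ℕ∞)) ∨
    (∃ a' b', Q.MuIn a' b' ∧ (b' : ℤ) - a' = (b : ℤ) - a)

end CPair

/-! ### Congruences on the natural numbers -/

/-! Raising an entry in the order on symbols weakens the condition it imposes. So for the forward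
half of (i) a pair of `cg P` stays in `cg Q` once `Q` gives its two elements a common symbol. Within
one row this follows from `θ_q`-relatedness, and for the symbols `λ`, `ρ`, `R` from their uniqueness
in rows 0 and 1. The one case not controlled entry by entry is a pair of ranks 0 and 1 joined by two
`μ`s. Such `μ`s before the minima are translates of the initial pair, and (b) says exactly that `Q`
sees them either past both minima or matched with the same shift (`exists_muIn`, `MuIn.shift`,
`mem_cg_of_matching`).

For the converse, each ingredient of a C-pair is recovered from test pairs. A pair with equal
partitions detects `θ_q`; rank 0 partitions with one large upper or lower block separate `λ`, `ρ`,
`R`; the rank 1 partitions `single x y` separate `μ↑`, `μ↓`, `μ`; the partitions `diag π` detect the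
normal subgroup in a row `q ≥ 2`; and `singletons` against `single x x` detects matching `μ`s. If `n
= 1` several of these partitions coincide, and being reduced replaces the lost information.

Parts (ii)-(iv) are parity arguments. The additional pairs of `cgx` have odd permutational
difference, while that of a partition with itself is the identity. Their numbers differ by odd
multiples of half the period `2d` of the exceptional row, and that row contains no `R`, because `R`
forces period 1. -/

theorem natCon_iff {m d i j : ℕ} :
    natCon m d i j ↔ i = j ∨ (m ≤ i ∧ m ≤ j ∧ i ≡ j [MOD d]) := Iff.rfl

theorem natCon_one_iff {m i j : ℕ} : natCon m 1 i j ↔ i = j ∨ (m ≤ i ∧ m ≤ j) := by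
  simp [natCon_iff, Nat.modEq_one]

theorem bot_con_iff {i j : ℕ} : (⊥ : AddCon ℕ) i j ↔ i = j := Iff.rfl

theorem conMin_le {θ : AddCon ℕ} {i j : ℕ} (hij : i ≠ j) (h : θ i j) : conMin θ ≤ (i : ℕ∞) :=
  sInf_le ⟨i, j, hij, h, rfl⟩

theorem conMin_bot : conMin ⊥ = ⊤ := by
  refine sInf_eq_top.2 ?_
  rintro x ⟨i, j, hij, h, -⟩
  exact absurd h hij

theorem conMin_natCon {m d : ℕ} (hd : 1 ≤ d) : conMin (natCon m d) = m := by
  apply le_antisymm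
  · refine conMin_le (j := m + d) (by omega) (Or.inr ⟨le_rfl, by omega, ?_⟩)
    simp [Nat.ModEq]
  · refine le_sInf ?_
    rintro x ⟨i, j, hij, h | ⟨h, -⟩, rfl⟩
    · exact absurd h hij
    · exact_mod_cast h

theorem conPer_natCon {m d : ℕ} (hd : 1 ≤ d) : conPer (natCon m d) = d := by
  apply le_antisymm
  · refine sInf_le ⟨m, d, hd, Or.inr ⟨le_rfl, by omega, ?_⟩, rfl⟩
    simp [Nat.ModEq]
  · refine le_sInf ?_
    rintro x ⟨i, e, he, h | ⟨-, -, h⟩, rfl⟩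
    · omega
    · have := (Nat.modEq_iff_dvd' (Nat.le_add_right i e)).1 h
      rw [Nat.add_sub_cancel_left] at this
      exact_mod_cast Nat.le_of_dvd he this

theorem natCon_inj {m d m' d' : ℕ} (hd : 1 ≤ d) (hd' : 1 ≤ d')
    (h : natCon m d = natCon m' d') : m = m' ∧ d = d' := by
  have h1 := congrArg conMin h
  have h2 := congrArg conPer h
  rw [conMin_natCon hd, conMin_natCon hd'] at h1
  rw [conPer_natCon hd, conPer_natCon hd'] at h2
  exact ⟨by exact_mod_cast h1, by exact_mod_cast h2⟩

theorem natCon_add_right {m d i : ℕ} (h : m ≤ i) : natCon m d i (i + d) :=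
  Or.inr ⟨h, by omega, by simp [Nat.ModEq]⟩

/-- Tested on the generating pair `(m, m + d)`. -/
theorem natCon_le_natCon {m d m' d' : ℕ} (hd : 1 ≤ d) (h : natCon m d ≤ natCon m' d') :
    m' ≤ m ∧ d' ∣ d := by
  rcases h (natCon_add_right (d := d) le_rfl) with h | ⟨h1, -, h⟩
  · omega
  · have := (Nat.modEq_iff_dvd' (Nat.le_add_right m d)).1 h
    rw [Nat.add_sub_cancel_left] at this
    exact ⟨h1, this⟩

/-- Compatibility with addition translates the step of length `e` from `m` to any later point, and
transitivity iterates it. -/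
theorem con_add_mul {θ : AddCon ℕ} {m e : ℕ} (h : θ m (m + e)) {i : ℕ} (hi : m ≤ i) (t : ℕ) :
    θ i (i + t * e) := by
  induction t with
  | zero => simpa using θ.refl i
  | succ t ih =>
    refine θ.trans ih ?_
    have := θ.add (θ.refl (i - m + t * e)) h
    convert this using 1
    · omega
    · rw [Nat.succ_mul]; omega

/-- Every non-trivial congruence on `ℕ` is of the form `(m, m+d)♯`. -/
theorem exists_eq_natCon {θ : AddCon ℕ} (h : θ ≠ ⊥) : ∃ m d, 1 ≤ d ∧ θ = natCon m d := by
  classical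
  have hex : ∃ m e, 1 ≤ e ∧ θ m (m + e) := by
    by_contra! hc
    refine h (le_antisymm (fun i j hij => ?_) bot_le)
    by_contra hne
    have hne : i ≠ j := hne
    rcases lt_or_gt_of_ne hne with hl | hl
    · exact hc i (j - i) (by omega) (by rwa [Nat.add_sub_cancel' hl.le])
    · exact hc j (i - j) (by omega) (by rw [Nat.add_sub_cancel' hl.le]; exact θ.symm hij)
  have hex' : ∃ d, 1 ≤ d ∧ ∃ i, θ i (i + d) := by
    obtain ⟨m, e, he, hm⟩ := hex
    exact ⟨e, he, m, hm⟩
  obtain ⟨e, he, hme⟩ := Nat.find_spec hex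
  obtain ⟨hd, i₀, hi₀⟩ := Nat.find_spec hex'
  set m := Nat.find hex
  set d := Nat.find hex'
  -- The least starting point `m` and the least difference `d` come from different pairs. From `m`
  -- go by steps of length `e` past `i₀`, make a step `d` there, and return by the translate by `d`
  -- of the way out.
  have hmd : θ m (m + d) := by
    have h1 := con_add_mul hme le_rfl i₀
    have h2 : i₀ ≤ m + i₀ * e := by nlinarith
    have h3 := con_add_mul hi₀ h2 1
    rw [one_mul] at h3
    have h4 := θ.add h1 (θ.refl d)
    exact θ.trans h1 (θ.trans h3 (θ.symm h4))
  have key : ∀ i j, i < j → θ i j → m ≤ i ∧ i ≡ j [MOD d] := by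
    intro i j hlt hij
    have hmi : m ≤ i := Nat.find_min' hex ⟨j - i, by omega, by rwa [Nat.add_sub_cancel' hlt.le]⟩
    refine ⟨hmi, (Nat.modEq_iff_dvd' hlt.le).2 ?_⟩
    by_contra hnd
    have hr : 1 ≤ (j - i) % d := Nat.one_le_iff_ne_zero.2 fun h0 => hnd (Nat.dvd_of_mod_eq_zero h0)
    have hdm := Nat.div_add_mod (j - i) d
    have h1 := con_add_mul hmd hmi ((j - i) / d)
    -- Removing whole steps of length `d` leaves the remainder as a related difference,
    -- contradicting the minimality of `d`.
    have h2 : θ (i + (j - i) / d * d) (i + (j - i) / d * d + (j - i) % d) := by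
      refine θ.trans (θ.symm h1) ?_
      convert hij using 1
      rw [mul_comm]; omega
    exact absurd (Nat.find_min' hex' ⟨hr, _, h2⟩) (not_le.2 (Nat.mod_lt _ hd))
  refine ⟨m, d, hd, le_antisymm (fun i j hij => ?_) (fun i j hij => ?_)⟩
  · rcases lt_trichotomy i j with hl | hl | hl
    · obtain ⟨h1, h2⟩ := key i j hl hij
      exact Or.inr ⟨h1, h1.trans hl.le, h2⟩
    · exact Or.inl hl
    · obtain ⟨h1, h2⟩ := key j i hl (θ.symm hij)
      exact Or.inr ⟨h1.trans hl.le, h1, h2.symm⟩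
  · rcases hij with rfl | ⟨h1, h2, h3⟩
    · exact θ.refl i
    · wlog hl : i ≤ j generalizing i j
      · exact θ.symm (this j i h2 h1 h3.symm (le_of_not_ge hl))
      obtain ⟨t, ht⟩ := (Nat.modEq_iff_dvd' hl).1 h3
      have := con_add_mul hmd h1 t
      convert this using 1
      rw [mul_comm]; omega

theorem conMin_le_of_le {θ θ' : AddCon ℕ} (h : θ ≤ θ') : conMin θ' ≤ conMin θ := by
  refine le_sInf ?_
  rintro x ⟨i, j, hij, hθ, rfl⟩
  exact conMin_le hij (h hθ)

namespace Partn

variable {n : ℕ}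

/-! ### Green's relations of the partition monoid -/

theorem prodGraph_left {α : Partn n} (β : Partn n) {a b : Fin n ⊕ Fin n} (h : α.rel a b) :
    prodGraph α β (Sum.map id Sum.inl a) (Sum.map id Sum.inl b) :=
  Relation.EqvGen.rel _ _ (Or.inl ⟨a, b, h, rfl, rfl⟩)

theorem prodGraph_right (α : Partn n) {β : Partn n} {a b : Fin n ⊕ Fin n} (h : β.rel a b) :
    prodGraph α β (Sum.inr a) (Sum.inr b) :=
  Relation.EqvGen.rel _ _ (Or.inr ⟨a, b, h, rfl, rfl⟩)

theorem prodGraph_le {α β : Partn n} {S : Setoid (Fin n ⊕ (Fin n ⊕ Fin n))}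
    (h1 : ∀ a b, α.rel a b → S (Sum.map id Sum.inl a) (Sum.map id Sum.inl b))
    (h2 : ∀ a b, β.rel a b → S (Sum.inr a) (Sum.inr b)) : prodGraph α β ≤ S := by
  refine Setoid.eqvGen_le ?_
  rintro x y (⟨a, b, h, rfl, rfl⟩ | ⟨a, b, h, rfl, rfl⟩)
  · exact h1 a b h
  · exact h2 a b h

/-- The upper vertex `x` lies in a transversal. -/
def Dom (α : Partn n) (x : Fin n) : Prop := ∃ y, α.rel (Sum.inl x) (Sum.inr y)

/-- The lower vertex `y` lies in a transversal. -/
def Codom (α : Partn n) (y : Fin n) : Prop := ∃ x, α.rel (Sum.inl x) (Sum.inr y)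

/-- The principal right ideal generated by a partition. -/
theorem mem_range_mul_left {α γ : Partn n} :
    γ ∈ Set.range (fun z => α * z) ↔
      (∀ x y, α.rel (Sum.inl x) (Sum.inl y) → γ.rel (Sum.inl x) (Sum.inl y)) ∧
      (∀ x, ¬ α.Dom x → ∀ v, γ.rel (Sum.inl x) v → ∃ y, v = Sum.inl y ∧
        α.rel (Sum.inl x) (Sum.inl y)) := by
  classical
  constructor
  · rintro ⟨z, rfl⟩
    refine ⟨fun x y h => prodGraph_left z h, fun x hx v hv => ?_⟩
    -- If `x` lies in no transversal, its `α`-block stays in the upper row and no edge of the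
    -- product graph leaves it, whatever `z` is.
    have hle : prodGraph α z ≤
        Setoid.ker fun w => ∃ y, w = Sum.inl y ∧ α.rel (Sum.inl x) (Sum.inl y) := by
      refine prodGraph_le ?_ ?_
      · rintro (a | a) (b | b) h <;> refine propext ?_ <;> simp
        · exact ⟨fun k => α.rel.trans k h, fun k => α.rel.trans k (α.rel.symm h)⟩
        · exact fun k => hx ⟨b, α.rel.trans k h⟩
        · exact fun k => hx ⟨a, α.rel.trans k (α.rel.symm h)⟩
      · intro a b h
        refine propext ?_
        simp
    have := (hle hv).mp ⟨x, rfl, α.rel.refl _⟩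
    obtain ⟨y, hy, h⟩ := this
    refine ⟨y, ?_, h⟩
    cases v <;> simp_all
  · rintro ⟨h1, h2⟩
    -- The factor `z` is the kernel of a labelling by blocks of `γ`: a lower vertex keeps its own
    -- block, and a middle vertex takes the block of the upper vertices that `α` joins to it. The
    -- remaining middle vertices get `none`, so they never link to an outer vertex.
    let g : Fin n → Option (Quotient γ.rel) := fun y =>
      if h : α.Codom y then some (Quotient.mk γ.rel (Sum.inl h.choose)) else none
    have hg : ∀ x y, α.rel (Sum.inl x) (Sum.inr y) →
        g y = some (Quotient.mk γ.rel (Sum.inl x)) := by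
      intro x y h
      have hc : α.Codom y := ⟨x, h⟩
      simp only [g, dif_pos hc, Option.some.injEq]
      exact Quotient.sound (h1 _ _ (α.rel.trans hc.choose_spec (α.rel.symm h)))
    let z : Partn n := ⟨Setoid.ker (Sum.elim g fun w => some (Quotient.mk γ.rel (Sum.inr w)))⟩
    refine ⟨z, Partn.ext (Setoid.ext fun a b => ⟨fun h => ?_, fun h => ?_⟩)⟩
    · have hle : prodGraph α z ≤ Setoid.ker (Sum.elim
          (fun x => some (Quotient.mk γ.rel (Sum.inl x)))
          (Sum.elim g fun w => some (Quotient.mk γ.rel (Sum.inr w)))) := by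
        refine prodGraph_le ?_ fun a b h => h
        rintro (a | a) (b | b) h
        · exact congrArg some (Quotient.sound (h1 _ _ h))
        · exact (hg _ _ h).symm
        · exact hg _ _ (α.rel.symm h)
        · show g a = g b
          by_cases hc : α.Codom a
          · obtain ⟨x, hx⟩ := hc
            rw [hg x a hx, hg x b (α.rel.trans hx h)]
          · have hc' : ¬ α.Codom b := fun ⟨x, hx⟩ => hc ⟨x, α.rel.trans hx (α.rel.symm h)⟩
            simp only [g, dif_neg hc, dif_neg hc']
      have := hle h
      rcases a with a | a <;> rcases b with b | b <;>
        exact Quotient.exact (Option.some.inj this)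
    · have hlow : ∀ x w, γ.rel (Sum.inl x) (Sum.inr w) → (α * z).rel (Sum.inl x) (Sum.inr w) := by
        intro x w h
        by_cases hx : α.Dom x
        · obtain ⟨y, hy⟩ := hx
          refine (prodGraph α z).trans (prodGraph_left z hy) (prodGraph_right α (?_ : g y = _))
          rw [hg x y hy]
          exact congrArg some (Quotient.sound h)
        · obtain ⟨y, hy, -⟩ := h2 x hx _ h
          cases hy
      rcases a with a | a <;> rcases b with b | b
      · by_cases ha : α.Dom a
        · by_cases hb : α.Dom b
          · obtain ⟨y, hy⟩ := ha
            obtain ⟨w, hw⟩ := hb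
            refine (prodGraph α z).trans (prodGraph_left z hy)
              ((prodGraph α z).trans (prodGraph_right α (?_ : g y = g w))
                ((prodGraph α z).symm (prodGraph_left z hw)))
            rw [hg a y hy, hg b w hw]
            exact congrArg some (Quotient.sound h)
          · obtain ⟨y, hy, k⟩ := h2 b hb _ (γ.rel.symm h)
            cases hy
            exact prodGraph_left z (α.rel.symm k)
        · obtain ⟨y, hy, k⟩ := h2 a ha _ h
          cases hy
          exact prodGraph_left z k
      · exact hlow _ _ h
      · exact (α * z).rel.symm (hlow _ _ (γ.rel.symm h))
      · exact prodGraph_right α (congrArg some (Quotient.sound h))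

/-- Two partitions are R-related iff they have the same upper kernel and the same domain. -/
theorem greenR_iff {α β : Partn n} :
    GreenR α β ↔ (∀ x y, α.rel (Sum.inl x) (Sum.inl y) ↔ β.rel (Sum.inl x) (Sum.inl y)) ∧
      ∀ x, α.Dom x ↔ β.Dom x := by
  constructor
  · intro h
    have self : ∀ γ : Partn n, γ ∈ Set.range (fun z => γ * z) := fun γ =>
      mem_range_mul_left.2 ⟨fun _ _ h => h, fun x hx v hv => by
        rcases v with v | v
        · exact ⟨v, rfl, hv⟩
        · exact absurd ⟨v, hv⟩ hx⟩
    have h1 := mem_range_mul_left.1 (h ▸ self α)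
    have h2 := mem_range_mul_left.1 (h.symm ▸ self β)
    have aux : ∀ {γ δ : Partn n} {x : Fin n}, (∀ x, ¬ γ.Dom x → ∀ v, δ.rel (Sum.inl x) v →
        ∃ y, v = Sum.inl y ∧ γ.rel (Sum.inl x) (Sum.inl y)) → δ.Dom x → γ.Dom x := by
      rintro γ δ x h ⟨y, hy⟩
      by_contra hx
      obtain ⟨w, hw, -⟩ := h x hx _ hy
      cases hw
    exact ⟨fun x y => ⟨h2.1 x y, h1.1 x y⟩, fun x => ⟨aux h1.2, aux h2.2⟩⟩
  · rintro ⟨h1, h2⟩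
    ext γ
    simp only [mem_range_mul_left, h1, h2]

/-- The reflection of a partition, interchanging the upper and the lower row. -/
def flip (α : Partn n) : Partn n := ⟨Setoid.comap Sum.swap α.rel⟩

theorem flip_rel (α : Partn n) (a b : Fin n ⊕ Fin n) :
    α.flip.rel a b ↔ α.rel a.swap b.swap := Iff.rfl

theorem flip_flip (α : Partn n) : α.flip.flip = α := by
  refine Partn.ext (Setoid.ext fun a b => ?_)
  simp [flip_rel]

/-- Turning the product graph upside down exchanges the factors. One inclusion is enough, since
`flip` is an involution. -/
theorem flip_mul_le {α β : Partn n} {a b : Fin n ⊕ Fin n} (h : (α * β).rel a b) :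
    (β.flip * α.flip).rel a.swap b.swap := by
  have hle : prodGraph α β ≤ Setoid.comap
      (Sum.elim (fun x => Sum.inr (Sum.inr x)) (Sum.elim (fun x => Sum.inr (Sum.inl x)) Sum.inl))
      (prodGraph β.flip α.flip) := by
    refine prodGraph_le ?_ ?_
    · intro a b h
      have h' : α.flip.rel a.swap b.swap := by simpa [flip_rel] using h
      have := prodGraph_right β.flip h'
      rcases a with a | a <;> rcases b with b | b <;> exact this
    · intro a b h
      have h' : β.flip.rel a.swap b.swap := by simpa [flip_rel] using h
      have := prodGraph_left α.flip h'
      rcases a with a | a <;> rcases b with b | b <;> exact this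
  have := hle h
  rcases a with a | a <;> rcases b with b | b <;> exact this

theorem flip_mul (α β : Partn n) : (α * β).flip = β.flip * α.flip := by
  refine Partn.ext (Setoid.ext fun a b => ⟨fun h => ?_, fun h => ?_⟩)
  · have := flip_mul_le h
    rwa [Sum.swap_swap, Sum.swap_swap] at this
  · have := flip_mul_le h
    rwa [flip_flip, flip_flip] at this

/-- An involutive anti-automorphism carries principal left ideals to principal right ideals, so only
the R-relation has to be computed. -/
theorem greenL_iff_flip {α β : Partn n} : GreenL α β ↔ GreenR α.flip β.flip := by
  have key : ∀ α : Partn n, Set.range (fun z => α.flip * z) =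
      flip ⁻¹' Set.range (fun z => z * α) := by
    intro α
    ext γ
    constructor
    · rintro ⟨z, rfl⟩
      exact ⟨z.flip, by simp only [flip_mul, flip_flip]⟩
    · rintro ⟨z, hz⟩
      refine ⟨z.flip, ?_⟩
      simp only [← flip_mul]
      rw [show z * α = γ.flip from hz, flip_flip]
  have hsurj : Function.Surjective (flip : Partn n → Partn n) := fun α => ⟨_, flip_flip α⟩
  rw [GreenR, key, key, hsurj.preimage_injective.eq_iff, GreenL]

/-- Two partitions are L-related iff they have the same lower kernel and the same codomain. -/
theorem greenL_iff {α β : Partn n} :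
    GreenL α β ↔ (∀ x y, α.rel (Sum.inr x) (Sum.inr y) ↔ β.rel (Sum.inr x) (Sum.inr y)) ∧
      ∀ x, α.Codom x ↔ β.Codom x := by
  have key : ∀ (α : Partn n) x, α.flip.Dom x ↔ α.Codom x := fun α x =>
    exists_congr fun y => ⟨fun h => α.rel.symm h, fun h => α.rel.symm h⟩
  rw [greenL_iff_flip, greenR_iff]
  simp only [key]
  rfl

/-! ### The permutational difference -/

theorem inl_union_inr_injective {A B A' B' : Set (Fin n)}
    (h : Sum.inl '' A ∪ Sum.inr '' B = (Sum.inl '' A' ∪ Sum.inr '' B' : Set (Fin n ⊕ Fin n))) :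
    A = A' ∧ B = B' := by
  constructor
  · ext x
    have := Set.ext_iff.1 h (Sum.inl x)
    simpa using this
  · ext x
    have := Set.ext_iff.1 h (Sum.inr x)
    simpa using this

theorem finite_transversals (α : Partn n) : α.transversals.Finite := Set.toFinite _

theorem permDiff_refl {α : Partn n} {q : ℕ} (hq : α.rank = q) :
    PermDiff α α (1 : Equiv.Perm (Fin q)) := by
  have : Nat.card α.transversals = q := hq
  have hfin : Finite α.transversals := α.finite_transversals
  let e : Fin q ≃ α.transversals := (finCongr this.symm).trans (Finite.equivFin _).symm
  have hu : ∀ S : Set (Fin n ⊕ Fin n), Sum.inl '' (Sum.inl ⁻¹' S) ∪ Sum.inr '' (Sum.inr ⁻¹' S) = S := by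
    intro S
    ext (x | x) <;> simp
  have hr : α.transversals = Set.range fun i => (e i : Set (Fin n ⊕ Fin n)) := by
    ext S
    constructor
    · intro hS
      exact ⟨e.symm ⟨S, hS⟩, by simp⟩
    · rintro ⟨i, rfl⟩
      exact (e i).2
  refine ⟨fun i => Sum.inl ⁻¹' (e i : Set (Fin n ⊕ Fin n)),
    fun i => Sum.inr ⁻¹' (e i : Set (Fin n ⊕ Fin n)), ?_, ?_, ?_, rfl⟩
  · simp only [hu]
    exact Subtype.val_injective.comp e.injective
  · simp only [hu]
    exact hr
  · simp only [hu, Equiv.Perm.coe_one, id]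
    exact hr

/-- The permutational difference is determined up to conjugacy. -/
theorem PermDiff.isConj {q : ℕ} {α β : Partn n} {π π' : Equiv.Perm (Fin q)}
    (h : PermDiff α β π) (h' : PermDiff α β π') : IsConj π' π := by
  obtain ⟨A, B, hinj, hα, hβ, -⟩ := h
  obtain ⟨A', B', hinj', hα', hβ', -⟩ := h'
  have hA : Function.Injective A := by
    intro i j hij
    have hi : Sum.inl '' A i ∪ Sum.inr '' B i ∈ α.transversals := hα ▸ ⟨i, rfl⟩
    have hj : Sum.inl '' A j ∪ Sum.inr '' B j ∈ α.transversals := hα ▸ ⟨j, rfl⟩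
    obtain ⟨x, hx⟩ := hi.2.1
    have hxA : x ∈ A i := by simpa using hx
    exact hinj (Setoid.eq_of_mem_classes hi.1 hx hj.1 (by simpa [← hij] using hxA))
  -- Both labellings list the transversals of `α`, so they differ by a re-indexing `σ`. Comparing
  -- the transversals of `β` then gives that `π` after `σ` equals `σ` after `π'`.
  have hσ : ∀ i, ∃ k, A' i = A k ∧ B' i = B k := by
    intro i
    have : Sum.inl '' A' i ∪ Sum.inr '' B' i ∈ α.transversals := hα' ▸ ⟨i, rfl⟩
    rw [hα] at this
    obtain ⟨k, hk⟩ := this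
    obtain ⟨h1, h2⟩ := inl_union_inr_injective hk
    exact ⟨k, h1.symm, h2.symm⟩
  choose σ hσA hσB using hσ
  have hσinj : Function.Injective σ := by
    intro i j hij
    refine hinj' ?_
    simp only [hσA, hσB, hij]
  have hB : Function.Injective B := by
    intro i j hij
    have hi : Sum.inl '' A i ∪ Sum.inr '' B i ∈ α.transversals := hα ▸ ⟨i, rfl⟩
    have hj : Sum.inl '' A j ∪ Sum.inr '' B j ∈ α.transversals := hα ▸ ⟨j, rfl⟩
    obtain ⟨x, hx⟩ := hi.2.2
    have hxB : x ∈ B i := by simpa using hx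
    exact hinj (Setoid.eq_of_mem_classes hi.1 hx hj.1 (by simpa [← hij] using hxB))
  let s : Equiv.Perm (Fin q) := Equiv.ofBijective σ (Finite.injective_iff_bijective.1 hσinj)
  refine isConj_iff.2 ⟨s, ?_⟩
  rw [mul_inv_eq_iff_eq_mul]
  ext1 i
  have : Sum.inl '' A' i ∪ Sum.inr '' B' (π' i) ∈ β.transversals := hβ' ▸ ⟨i, rfl⟩
  rw [hβ] at this
  obtain ⟨k, hk⟩ := this
  obtain ⟨h1, h2⟩ := inl_union_inr_injective hk
  have hk' : k = σ i := hA (h1.trans (hσA i))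
  have : π k = σ (π' i) := hB (h2.trans (hσB _))
  show σ (π' i) = π (σ i)
  rw [← this, hk']

/-- The labelling in the hypothesis also exhibits the identity, whose conjugacy class is a
singleton. -/
theorem PermDiff.eq_one {q : ℕ} {α : Partn n} {π : Equiv.Perm (Fin q)}
    (h : PermDiff α α π) : π = 1 := by
  have h1 : PermDiff α α (1 : Equiv.Perm (Fin q)) := by
    obtain ⟨A, B, hinj, hα, -, -⟩ := h
    exact ⟨A, B, hinj, hα, hα, rfl⟩
  exact isConj_one_right.1 (h.isConj h1)

/-- Normality makes membership independent of the labelling. -/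
theorem PermDiff.mem_of_mem {q : ℕ} {α β : Partn n} {π π' : Equiv.Perm (Fin q)}
    {H : Subgroup (Equiv.Perm (Fin q))} (hH : H.Normal)
    (h : PermDiff α β π) (h' : PermDiff α β π') (hπ : π' ∈ H) : π ∈ H := by
  obtain ⟨c, hc⟩ := isConj_iff.1 (h.isConj h')
  exact hc ▸ hH.conj_mem _ hπ c

/-! ### Some partitions -/

/-- A labelling of the vertices by the blocks of the partition `diag π`. -/
def diagLabel {q : ℕ} (π : Equiv.Perm (Fin q)) : Fin n ⊕ Fin n → Fin q ⊕ (Fin n ⊕ Fin n) :=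
  Sum.elim
    (fun x => if h : (x : ℕ) < q then Sum.inl (π ⟨x, h⟩) else Sum.inr (Sum.inl x))
    (fun y => if h : (y : ℕ) < q then Sum.inl ⟨y, h⟩ else Sum.inr (Sum.inr y))

/-- The partition of rank `q` with transversals `{x, (xπ)'}` for `x < q` and all other blocks
singletons. -/
def diag {q : ℕ} (π : Equiv.Perm (Fin q)) : Partn n := ⟨Setoid.ker (diagLabel π)⟩

theorem diag_rel {q : ℕ} {π : Equiv.Perm (Fin q)} {a b : Fin n ⊕ Fin n} :
    (diag π).rel a b ↔ diagLabel π a = diagLabel π b := Iff.rfl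

theorem diag_rel_inl_inl {q : ℕ} (π : Equiv.Perm (Fin q)) (x y : Fin n) :
    (diag π : Partn n).rel (Sum.inl x) (Sum.inl y) ↔ x = y := by
  simp only [diag_rel, diagLabel, Sum.elim_inl]
  split_ifs <;> simp [Fin.ext_iff] <;> omega

theorem diag_rel_inr_inr {q : ℕ} (π : Equiv.Perm (Fin q)) (x y : Fin n) :
    (diag π : Partn n).rel (Sum.inr x) (Sum.inr y) ↔ x = y := by
  simp only [diag_rel, diagLabel, Sum.elim_inr]
  split_ifs <;> simp [Fin.ext_iff] <;> omega

theorem diag_rel_inl_inr {q : ℕ} (π : Equiv.Perm (Fin q)) (x y : Fin n) :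
    (diag π : Partn n).rel (Sum.inl x) (Sum.inr y) ↔
      ∃ (hx : (x : ℕ) < q), (π ⟨x, hx⟩ : ℕ) = y := by
  simp only [diag_rel, diagLabel, Sum.elim_inr, Sum.elim_inl]
  split_ifs with h1 h2 h2
  · simp [Fin.ext_iff, h1]
  · simp only [false_iff, not_exists]
    intro _ h
    omega
  · simp [h1]
  · simp [h1]

theorem diag_dom {q : ℕ} (hq : q ≤ n) (π : Equiv.Perm (Fin q)) (x : Fin n) :
    (diag π : Partn n).Dom x ↔ (x : ℕ) < q := by
  simp only [Dom, diag_rel_inl_inr]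
  refine ⟨fun ⟨_, h, _⟩ => h, fun h => ⟨Fin.castLE hq (π ⟨x, h⟩), h, rfl⟩⟩

theorem diag_codom {q : ℕ} (hq : q ≤ n) (π : Equiv.Perm (Fin q)) (x : Fin n) :
    (diag π : Partn n).Codom x ↔ (x : ℕ) < q := by
  simp only [Codom, diag_rel_inl_inr]
  refine ⟨fun ⟨_, h, h'⟩ => by omega, fun h => ⟨Fin.castLE hq (π.symm ⟨x, h⟩), ?_, ?_⟩⟩
  · simp
  · simp

theorem diag_greenH {q : ℕ} (hq : q ≤ n) (π σ : Equiv.Perm (Fin q)) :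
    GreenH (diag π : Partn n) (diag σ) := by
  constructor
  · rw [greenR_iff]
    simp [diag_rel_inl_inl, diag_dom hq]
  · rw [greenL_iff]
    simp [diag_rel_inr_inr, diag_codom hq]

theorem diag_transversals {q : ℕ} (hq : q ≤ n) (π : Equiv.Perm (Fin q)) :
    (diag π : Partn n).transversals = Set.range fun i =>
      Sum.inl '' {Fin.castLE hq i} ∪ Sum.inr '' {Fin.castLE hq (π i)} := by
  have key : ∀ i : Fin q, (Sum.inl '' {Fin.castLE hq i} ∪ Sum.inr '' {Fin.castLE hq (π i)} :
      Set (Fin n ⊕ Fin n)) = {v | (diag π : Partn n).rel v (Sum.inl (Fin.castLE hq i))} := by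
    intro i
    ext (x | x)
    · simp [diag_rel_inl_inl]
    · simp only [Set.mem_ofPred_eq, Setoid.comm' (diag π).rel (x := Sum.inr x), diag_rel_inl_inr]
      simp [Fin.ext_iff, eq_comm]
  ext C
  constructor
  · rintro ⟨⟨v, rfl⟩, ⟨x, hx⟩, ⟨y, hy⟩⟩
    have hxy := (diag π : Partn n).rel.trans hx ((diag π : Partn n).rel.symm hy)
    obtain ⟨h, -⟩ := (diag_rel_inl_inr π x y).1 hxy
    refine ⟨⟨x, h⟩, ?_⟩
    refine (key _).trans ?_
    ext w
    exact ⟨fun k => (diag π : Partn n).rel.trans k hx,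
      fun k => (diag π : Partn n).rel.trans k ((diag π : Partn n).rel.symm hx)⟩
  · rintro ⟨i, rfl⟩
    refine ⟨⟨_, key i⟩, ⟨Fin.castLE hq i, by simp⟩, ⟨Fin.castLE hq (π i), by simp⟩⟩

theorem castLE_union_injective {q : ℕ} (hq : q ≤ n) (f : Fin q → Fin n) :
    Function.Injective fun i => (Sum.inl '' {Fin.castLE hq i} ∪ Sum.inr '' {f i} :
      Set (Fin n ⊕ Fin n)) := by
  intro i j hij
  have := (inl_union_inr_injective hij).1
  exact Fin.castLE_injective hq (Set.singleton_injective this)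

theorem diag_rank {q : ℕ} (hq : q ≤ n) (π : Equiv.Perm (Fin q)) :
    (diag π : Partn n).rank = q := by
  rw [rank, diag_transversals hq, ← Set.image_univ,
    Set.ncard_image_of_injective _ (castLE_union_injective hq _), Set.ncard_univ, Nat.card_fin]

/-- The blocks that are not transversals are the singletons of the vertices with index at least `q`,
whatever the permutation. -/
theorem diag_permDiff {q : ℕ} (hq : q ≤ n) (π : Equiv.Perm (Fin q)) :
    PermDiff (diag (1 : Equiv.Perm (Fin q)) : Partn n) (diag π) π := by
  refine ⟨fun i => {Fin.castLE hq i}, fun i => {Fin.castLE hq i},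
    castLE_union_injective hq _, diag_transversals hq 1, diag_transversals hq π, ?_⟩
  have key : ∀ (σ τ : Equiv.Perm (Fin q)) (C : Set (Fin n ⊕ Fin n)),
      C ∈ (diag σ : Partn n).rel.classes \ (diag σ : Partn n).transversals →
      C ∈ (diag τ : Partn n).rel.classes \ (diag τ : Partn n).transversals := by
    rintro σ τ C ⟨⟨v, rfl⟩, hC⟩
    have hv : ∀ ρ : Equiv.Perm (Fin q), ((∃ x : Fin n, v = Sum.inl x ∧ ¬ (x : ℕ) < q) ∨
        ∃ x : Fin n, v = Sum.inr x ∧ ¬ (x : ℕ) < q) →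
        {w | (diag ρ : Partn n).rel w v} = {v} := by
      rintro ρ (⟨x, rfl, hx⟩ | ⟨x, rfl, hx⟩) <;> ext (y | y)
      · simp [diag_rel_inl_inl]
      · rw [Set.mem_ofPred_eq, Setoid.comm', diag_rel_inl_inr]
        simp [hx]
      · rw [Set.mem_ofPred_eq, diag_rel_inl_inr]
        simp only [Set.mem_singleton_iff, reduceCtorEq, iff_false, not_exists]
        intro _ h
        omega
      · simp [diag_rel_inr_inr]
    have hv' : (∃ x : Fin n, v = Sum.inl x ∧ ¬ (x : ℕ) < q) ∨
        ∃ x : Fin n, v = Sum.inr x ∧ ¬ (x : ℕ) < q := by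
      by_contra! hc
      refine hC ⟨⟨v, rfl⟩, ?_⟩
      rcases v with x | x
      · refine ⟨⟨x, (diag σ).rel.refl _⟩, ?_⟩
        obtain ⟨y, hy⟩ := (diag_dom hq σ x).2 (hc.1 x rfl)
        exact ⟨y, (diag σ).rel.symm hy⟩
      · obtain ⟨y, hy⟩ := (diag_codom hq σ x).2 (hc.2 x rfl)
        exact ⟨⟨y, hy⟩, x, (diag σ).rel.refl _⟩
    refine ⟨⟨v, by rw [hv σ hv', hv τ hv']⟩, ?_⟩
    rw [hv σ hv']
    rintro ⟨-, ⟨x, hx⟩, y, hy⟩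
    rw [Set.mem_singleton_iff] at hx hy
    rw [← hx] at hy
    cases hy
  exact Set.ext fun C => ⟨key (1 : Equiv.Perm (Fin q)) π C, key π 1 C⟩

/-! ### Test partitions of ranks 0 and 1 -/

theorem rank_eq_zero {α : Partn n} (h : ∀ x y, ¬ α.rel (Sum.inl x) (Sum.inr y)) :
    α.rank = 0 := by
  have : α.transversals = ∅ := by
    rw [Set.eq_empty_iff_forall_notMem]
    rintro C ⟨⟨v, rfl⟩, ⟨x, hx⟩, y, hy⟩
    exact h x y (α.rel.trans hx (α.rel.symm hy))
  rw [rank, this, Set.ncard_empty]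

theorem hat_eq_self {α : Partn n} (h : ∀ x y, ¬ α.rel (Sum.inl x) (Sum.inr y)) :
    α.hat = α := by
  refine Partn.ext (Setoid.ext fun a b => ⟨fun k => k.1, fun k => ⟨k, ?_⟩⟩)
  rcases a with a | a <;> rcases b with b | b <;> try rfl
  · exact absurd k (h _ _)
  · exact absurd (α.rel.symm k) (h _ _)

/-- The partition into singletons. -/
def singletons : Partn n := ⟨⊥⟩

theorem singletons_rel {a b : Fin n ⊕ Fin n} : singletons.rel a b ↔ a = b := Iff.rfl

theorem singletons_not_rel (x y : Fin n) : ¬ singletons.rel (Sum.inl x) (Sum.inr y) := by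
  simp [singletons_rel]

/-- The partition with a single upper block and all lower blocks singletons. -/
def upperBlock : Partn n := ⟨Setoid.ker (Sum.elim (fun _ => none) some)⟩

theorem upperBlock_rel {a b : Fin n ⊕ Fin n} : upperBlock.rel a b ↔
    (Sum.elim (fun _ => none) some a : Option (Fin n)) = Sum.elim (fun _ => none) some b := Iff.rfl

theorem upperBlock_not_rel (x y : Fin n) : ¬ upperBlock.rel (Sum.inl x) (Sum.inr y) := by
  simp [upperBlock_rel]

/-- The partition with a single lower block and all upper blocks singletons. -/
def lowerBlock : Partn n := ⟨Setoid.ker (Sum.elim some (fun _ => none))⟩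

theorem lowerBlock_rel {a b : Fin n ⊕ Fin n} : lowerBlock.rel a b ↔
    (Sum.elim some (fun _ => none) a : Option (Fin n)) = Sum.elim some (fun _ => none) b := Iff.rfl

theorem lowerBlock_not_rel (x y : Fin n) : ¬ lowerBlock.rel (Sum.inl x) (Sum.inr y) := by
  simp [lowerBlock_rel]

/-- The partition of rank 1 with transversal `{x, y'}` and all other blocks singletons. -/
def single (x y : Fin n) : Partn n :=
  ⟨Setoid.ker (Sum.elim (fun a => if a = x then none else some (Sum.inl a))
    (fun b => if b = y then none else some (Sum.inr b)) : Fin n ⊕ Fin n → Option (Fin n ⊕ Fin n))⟩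

theorem single_rel {x y : Fin n} {a b : Fin n ⊕ Fin n} : (single x y).rel a b ↔
    (Sum.elim (fun a => if a = x then none else some (Sum.inl a))
      (fun b => if b = y then none else some (Sum.inr b)) a : Option (Fin n ⊕ Fin n)) =
    Sum.elim (fun a => if a = x then none else some (Sum.inl a))
      (fun b => if b = y then none else some (Sum.inr b)) b := Iff.rfl

theorem single_rel_inl_inl (x y a b : Fin n) :
    (single x y).rel (Sum.inl a) (Sum.inl b) ↔ a = b := by
  simp only [single_rel, Sum.elim_inl]
  split_ifs <;> simp_all [eq_comm]

theorem single_rel_inr_inr (x y a b : Fin n) :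
    (single x y).rel (Sum.inr a) (Sum.inr b) ↔ a = b := by
  simp only [single_rel, Sum.elim_inr]
  split_ifs <;> simp_all [eq_comm]

theorem single_rel_inl_inr (x y a b : Fin n) :
    (single x y).rel (Sum.inl a) (Sum.inr b) ↔ a = x ∧ b = y := by
  simp only [single_rel, Sum.elim_inr, Sum.elim_inl]
  split_ifs <;> simp_all

theorem single_dom (x y a : Fin n) : (single x y).Dom a ↔ a = x := by
  simp [Dom, single_rel_inl_inr]

theorem single_codom (x y a : Fin n) : (single x y).Codom a ↔ a = y := by
  simp [Codom, single_rel_inl_inr]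

theorem single_hat (x y : Fin n) : (single x y).hat = singletons := by
  refine Partn.ext (Setoid.ext fun a b => ?_)
  show (single x y).rel a b ∧ a.isLeft = b.isLeft ↔ a = b
  rcases a with a | a <;> rcases b with b | b <;>
    simp [single_rel_inl_inl, single_rel_inr_inr]

theorem single_rank (x y : Fin n) : (single x y).rank = 1 := by
  refine Set.ncard_eq_one.2 ⟨{v | (single x y).rel v (Sum.inl x)}, Set.ext fun C => ⟨?_, ?_⟩⟩
  · rintro ⟨⟨v, rfl⟩, ⟨a, ha⟩, b, hb⟩
    obtain ⟨rfl, rfl⟩ := (single_rel_inl_inr _ _ _ _).1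
      ((single x y).rel.trans ha ((single x y).rel.symm hb))
    ext w
    exact ⟨fun k => (single a b).rel.trans k ((single a b).rel.symm ha),
      fun k => (single a b).rel.trans k ha⟩
  · rintro rfl
    exact ⟨⟨_, rfl⟩, ⟨x, (single x y).rel.refl _⟩, y,
      (single x y).rel.symm ((single_rel_inl_inr x y x y).2 ⟨rfl, rfl⟩)⟩

theorem single_greenR_iff {x y x' y' : Fin n} : GreenR (single x y) (single x' y') ↔ x = x' := by
  rw [greenR_iff]
  simp only [single_rel_inl_inl, single_dom, implies_true, true_and]
  exact ⟨fun h => (h x).1 rfl, fun h _ => by rw [h]⟩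

theorem single_greenL_iff {x y x' y' : Fin n} : GreenL (single x y) (single x' y') ↔ y = y' := by
  rw [greenL_iff]
  simp only [single_rel_inr_inr, single_codom, implies_true, true_and]
  exact ⟨fun h => (h y).1 rfl, fun h _ => by rw [h]⟩

theorem greenL_singletons_upperBlock : GreenL (singletons : Partn n) upperBlock := by
  rw [greenL_iff]
  simp only [Codom, singletons_not_rel, upperBlock_not_rel, implies_true, and_true]
  simp [singletons_rel, upperBlock_rel]

theorem greenR_singletons_lowerBlock : GreenR (singletons : Partn n) lowerBlock := by
  rw [greenR_iff]
  simp only [Dom, singletons_not_rel, lowerBlock_not_rel, implies_true, and_true]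
  simp [singletons_rel, lowerBlock_rel]

/-- Two upper vertices are needed: for `n = 1` the partitions `upperBlock`, `lowerBlock` and
`singletons` coincide, which is why degree 1 needs reduced C-pairs. -/
theorem not_greenR_upperBlock (hn : 2 ≤ n) {α : Partn n}
    (hα : ∀ x y, α.rel (Sum.inl x) (Sum.inl y) → x = y) : ¬ GreenR α upperBlock := by
  intro h
  have := ((greenR_iff.1 h).1 ⟨0, by omega⟩ ⟨1, by omega⟩).2 rfl
  simpa using hα _ _ this

theorem not_greenL_lowerBlock (hn : 2 ≤ n) {α : Partn n}
    (hα : ∀ x y, α.rel (Sum.inr x) (Sum.inr y) → x = y) : ¬ GreenL α lowerBlock := by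
  intro h
  have := ((greenL_iff.1 h).1 ⟨0, by omega⟩ ⟨1, by omega⟩).2 rfl
  simpa using hα _ _ this

end Partn

namespace CPair

variable {n : ℕ} (P : CPair n)

/-! ### The shape of the matrix of a C-pair -/

/-- The symbols `λ, ρ, R`. -/
def _root_.Entry.IsWide (s : Entry) : Prop := s = .lam ∨ s = .rho ∨ s = .R

theorem eq_zero_or_one_or {q : ℕ} (h : q ≤ n) : q = 0 ∨ q = 1 ∨ (2 ≤ q ∧ q ≤ n) := by omega

variable {P}

/-- Entries from position `min θ_q` on are constant along a row. -/
theorem M_eq_of_conMin_le {q i j : ℕ} (hq : q ≤ n) (hi : conMin (P.θ q) ≤ (i : ℕ∞))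
    (hj : conMin (P.θ q) ≤ (j : ℕ∞)) : P.M q i = P.M q j := by
  rcases eq_zero_or_one_or hq with rfl | rfl | ⟨h2, hn⟩
  · rcases P.lowRows with h | ⟨a, h0, h1, ζ, hζ, r0, r1⟩ | ⟨m, h0, ξ, hξ, r0, r1⟩ |
      ⟨m, d, hd, h0, h1, ξ, hξ, r0, r1⟩ | ⟨a, m, d, hd, h0, h1, ha, ζ, ξ, hζ, hξ, r0, r1⟩ |
      ⟨m, l, d, hd, h0, h1, hl, ζ, ξ, hζ, hξ, r0, r1⟩ |
      ⟨m, l, d, hd, h0, h1, hm, hl, hmod, ξ, hξ, r0, r1⟩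
    · rw [(h i).1, (h j).1]
    · simp [h0, conMin_bot] at hi
    · simp only [h0, conMin_natCon le_rfl, Nat.cast_le] at hi hj
      rw [r0, r0]
      split_ifs <;> first | rfl | omega
    all_goals
      simp only [h0, conMin_natCon hd, Nat.cast_le] at hi hj
      rw [r0, r0]
      split_ifs <;> first | rfl | omega
  · rcases P.lowRows with h | ⟨a, h0, h1, ζ, hζ, r0, r1⟩ | ⟨m, h0, ξ, hξ, r0, r1⟩ |
      ⟨m, d, hd, h0, h1, ξ, hξ, r0, r1⟩ | ⟨a, m, d, hd, h0, h1, ha, ζ, ξ, hζ, hξ, r0, r1⟩ |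
      ⟨m, l, d, hd, h0, h1, hl, ζ, ξ, hζ, hξ, r0, r1⟩ |
      ⟨m, l, d, hd, h0, h1, hm, hl, hmod, ξ, hξ, r0, r1⟩
    · rw [(h i).2, (h j).2]
    · simp [h1, conMin_bot] at hi
    · rw [r1, r1]
    all_goals
      simp only [h1, conMin_natCon hd, Nat.cast_le] at hi hj
      rw [r1, r1]
      split_ifs <;> first | rfl | omega
  · rcases P.highRows q h2 hn with h | ⟨a, k, H, hak, hk, hH, hc, r⟩ | ⟨a, m, H, ham, hθ, hH, hH', r⟩
    · rw [h, h]
    · have hki : k ≤ i := by exact_mod_cast hk.trans hi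
      have hkj : k ≤ j := by exact_mod_cast hk.trans hj
      rw [r, r, if_neg (by omega), if_neg (by omega), hc i hki, hc j hkj]
    · simp only [hθ, conMin_natCon le_rfl, Nat.cast_le] at hi hj
      rw [r, r, if_neg (by omega), if_neg (by omega), if_neg (by omega), if_neg (by omega)]

theorem M_eq_of_rel {q i j : ℕ} (hq : q ≤ n) (h : P.θ q i j) : P.M q i = P.M q j := by
  by_cases hij : i = j
  · rw [hij]
  · exact M_eq_of_conMin_le hq (conMin_le hij h) (conMin_le (Ne.symm hij) ((P.θ q).symm h))

/-- The entries `λ, ρ, R` only occur in rows of period `1`, from position `min θ_q` on. -/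
theorem exists_natCon_one {q i : ℕ} (hq : q ≤ n) (h : (P.M q i).IsWide) :
    ∃ m, P.θ q = natCon m 1 ∧ m ≤ i := by
  rcases eq_zero_or_one_or hq with rfl | rfl | ⟨h2, hn⟩
  · rcases P.lowRows with h' | ⟨a, h0, h1, ζ, hζ, r0, r1⟩ | ⟨m, h0, ξ, hξ, r0, r1⟩ |
      ⟨m, d, hd, h0, h1, ξ, hξ, r0, r1⟩ | ⟨a, m, d, hd, h0, h1, ha, ζ, ξ, hζ, hξ, r0, r1⟩ |
      ⟨m, l, d, hd, h0, h1, hl, ζ, ξ, hζ, hξ, r0, r1⟩ |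
      ⟨m, l, d, hd, h0, h1, hm, hl, hmod, ξ, hξ, r0, r1⟩
    · simp [(h' i).1, Entry.IsWide] at h
    · rw [r0] at h
      split_ifs at h <;> simp [Entry.IsWide] at h
    · refine ⟨m, h0, ?_⟩
      rw [r0] at h
      split_ifs at h <;> simp [Entry.IsWide] at h
      omega
    all_goals
      rw [r0] at h
      split_ifs at h
      all_goals try simp [Entry.IsWide] at h
      rcases hξ with rfl | ⟨rfl, hξ⟩
      · simp at h
      · exact ⟨m, h0, by omega⟩
  · rcases P.lowRows with h' | ⟨a, h0, h1, ζ, hζ, r0, r1⟩ | ⟨m, h0, ξ, hξ, r0, r1⟩ |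
      ⟨m, d, hd, h0, h1, ξ, hξ, r0, r1⟩ | ⟨a, m, d, hd, h0, h1, ha, ζ, ξ, hζ, hξ, r0, r1⟩ |
      ⟨m, l, d, hd, h0, h1, hl, ζ, ξ, hζ, hξ, r0, r1⟩ |
      ⟨m, l, d, hd, h0, h1, hm, hl, hmod, ξ, hξ, r0, r1⟩
    · simp [(h' i).2, Entry.IsWide] at h
    · rw [r1] at h
      split_ifs at h <;> rcases hζ with rfl | rfl | rfl | rfl <;> simp [Entry.IsWide] at h
    · simp [r1, Entry.IsWide] at h
    all_goals
      rw [r1] at h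
      split_ifs at h
      all_goals try (rcases hζ with rfl | rfl | rfl | rfl)
      all_goals try simp [Entry.IsWide] at h
      all_goals
        rcases hξ with rfl | ⟨rfl, hξ⟩
        · simp at h
        · exact ⟨_, h1, by omega⟩
  · rcases P.highRows q h2 hn with h' | ⟨a, k, H, hak, hk, hH, hc, r⟩ |
      ⟨a, m, H, ham, hθ, hH, hH', r⟩
    · simp [h' i, Entry.IsWide] at h
    · rw [r] at h
      split_ifs at h <;> simp [Entry.IsWide] at h
    · refine ⟨m, hθ, ?_⟩
      rw [r] at h
      split_ifs at h <;> simp [Entry.IsWide] at h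
      omega

theorem conMin_le_of_isWide {q i : ℕ} (hq : q ≤ n) (h : (P.M q i).IsWide) :
    conMin (P.θ q) ≤ (i : ℕ∞) := by
  obtain ⟨m, hm, hi⟩ := exists_natCon_one hq h
  rw [hm, conMin_natCon le_rfl]
  exact_mod_cast hi

/-- These symbols force period 1, where all positions from the minimum on are related. -/
theorem rel_of_isWide {q i j : ℕ} (hq : q ≤ n) (h : (P.M q i).IsWide) (h' : (P.M q j).IsWide) :
    P.θ q i j := by
  obtain ⟨m, hm, hi⟩ := exists_natCon_one hq h
  obtain ⟨m', hm', hj⟩ := exists_natCon_one hq h'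
  obtain ⟨rfl, -⟩ := natCon_inj le_rfl le_rfl (hm.symm.trans hm')
  rw [hm, natCon_one_iff]
  exact Or.inr ⟨hi, hj⟩

/-- The possible entries of row `0`. -/
theorem row_zero (i : ℕ) : P.M 0 i = .delta ∨ P.M 0 i = .mu ∨ (P.M 0 i).IsWide := by
  rcases P.lowRows with h' | ⟨a, h0, h1, ζ, hζ, r0, r1⟩ | ⟨m, h0, ξ, hξ, r0, r1⟩ |
      ⟨m, d, hd, h0, h1, ξ, hξ, r0, r1⟩ | ⟨a, m, d, hd, h0, h1, ha, ζ, ξ, hζ, hξ, r0, r1⟩ |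
      ⟨m, l, d, hd, h0, h1, hl, ζ, ξ, hζ, hξ, r0, r1⟩ |
      ⟨m, l, d, hd, h0, h1, hm, hl, hmod, ξ, hξ, r0, r1⟩
  · simp [(h' i).1]
  · rw [r0]; split_ifs <;> simp
  · rw [r0]; rcases hξ with rfl | rfl | rfl <;> split_ifs <;> simp [Entry.IsWide]
  all_goals
    rw [r0]
    rcases hξ with rfl | ⟨rfl, rfl | rfl | rfl⟩ <;> split_ifs <;> simp [Entry.IsWide]

/-- The possible entries of row `1`. -/
theorem row_one (i : ℕ) : P.M 1 i = .delta ∨ P.M 1 i = .muUp ∨ P.M 1 i = .muDown ∨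
    P.M 1 i = .mu ∨ (P.M 1 i).IsWide := by
  rcases P.lowRows with h' | ⟨a, h0, h1, ζ, hζ, r0, r1⟩ | ⟨m, h0, ξ, hξ, r0, r1⟩ |
      ⟨m, d, hd, h0, h1, ξ, hξ, r0, r1⟩ | ⟨a, m, d, hd, h0, h1, ha, ζ, ξ, hζ, hξ, r0, r1⟩ |
      ⟨m, l, d, hd, h0, h1, hl, ζ, ξ, hζ, hξ, r0, r1⟩ |
      ⟨m, l, d, hd, h0, h1, hm, hl, hmod, ξ, hξ, r0, r1⟩
  · simp [(h' i).2]
  · rw [r1]; rcases hζ with rfl | rfl | rfl | rfl <;> split_ifs <;> simp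
  · simp [r1]
  all_goals
    rw [r1]
    try (rcases hζ with rfl | rfl | rfl | rfl)
    all_goals
      rcases hξ with rfl | ⟨rfl, rfl | rfl | rfl⟩ <;> split_ifs <;> simp [Entry.IsWide]

/-- The possible entries of the rows `q ≥ 2`. -/
theorem row_ge_two {q : ℕ} (h2 : 2 ≤ q) (hq : q ≤ n) (i : ℕ) : P.M q i = .delta ∨
    (∃ H : Subgroup (Equiv.Perm (Fin q)), P.M q i = .N q H ∧ H.Normal ∧ H ≠ ⊥) ∨
    P.M q i = .R := by
  rcases P.highRows q h2 hq with h' | ⟨a, k, H, hak, hk, hH, hc, r⟩ | ⟨a, m, H, ham, hθ, hH, hH', r⟩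
  · exact Or.inl (h' i)
  · rw [r]
    split_ifs with h
    · exact Or.inl rfl
    · obtain ⟨h3, h4, -⟩ := hH i (by omega)
      exact Or.inr (Or.inl ⟨_, rfl, h3, h4⟩)
  · rw [r]
    split_ifs with h h'
    · exact Or.inl rfl
    · obtain ⟨h3, h4⟩ := hH i (by omega) h'
      exact Or.inr (Or.inl ⟨_, rfl, h3, h4⟩)
    · exact Or.inr (Or.inr rfl)

/-- The symbols `μ↑` and `μ↓` occur at most once. -/
theorem row_one_arrow_unique {i j : ℕ} (hi : P.M 1 i = .muUp ∨ P.M 1 i = .muDown)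
    (hj : P.M 1 j = .muUp ∨ P.M 1 j = .muDown) : i = j := by
  rcases P.lowRows with h' | ⟨a, h0, h1, ζ, hζ, r0, r1⟩ | ⟨m, h0, ξ, hξ, r0, r1⟩ |
      ⟨m, d, hd, h0, h1, ξ, hξ, r0, r1⟩ | ⟨a, m, d, hd, h0, h1, ha, ζ, ξ, hζ, hξ, r0, r1⟩ |
      ⟨m, l, d, hd, h0, h1, hl, ζ, ξ, hζ, hξ, r0, r1⟩ |
      ⟨m, l, d, hd, h0, h1, hm, hl, hmod, ξ, hξ, r0, r1⟩
  · simp [(h' i).2] at hi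
  · rw [r1] at hi hj
    split_ifs at hi hj <;>
      first | omega | simp at hi | simp at hj
  · simp [r1] at hi
  all_goals
    rw [r1] at hi hj
    rcases hξ with rfl | ⟨rfl, rfl | rfl | rfl⟩ <;> split_ifs at hi hj <;>
      first | omega | simp at hi | simp at hj

/-- The non-`Δ` entries of rows `0` and `1` from the positions `min θ_q` on all agree. -/
theorem M_eq_of_conMin_le_low {i j : ℕ} (hi : conMin (P.θ 0) ≤ (i : ℕ∞))
    (hj : conMin (P.θ 1) ≤ (j : ℕ∞)) (h : P.M 1 j ≠ .delta) : P.M 0 i = P.M 1 j := by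
  rcases P.lowRows with h' | ⟨a, h0, h1, ζ, hζ, r0, r1⟩ | ⟨m, h0, ξ, hξ, r0, r1⟩ |
      ⟨m, d, hd, h0, h1, ξ, hξ, r0, r1⟩ | ⟨a, m, d, hd, h0, h1, ha, ζ, ξ, hζ, hξ, r0, r1⟩ |
      ⟨m, l, d, hd, h0, h1, hl, ζ, ξ, hζ, hξ, r0, r1⟩ |
      ⟨m, l, d, hd, h0, h1, hm, hl, hmod, ξ, hξ, r0, r1⟩
  · exact absurd (h' j).2 h
  · simp [h0, conMin_bot] at hi
  · exact absurd (r1 j) h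
  all_goals
    simp only [h0, h1, conMin_natCon hd, Nat.cast_le] at hi hj
    rw [r0, r1]
    split_ifs <;> first | rfl | omega

/-- The chain condition puts a position past `min θ_1` also past `min θ_0`, where the two rows
agree. -/
theorem row_zero_eq_of_isWide {i : ℕ} (hn : 1 ≤ n) (h : (P.M 1 i).IsWide) :
    P.M 0 i = P.M 1 i := by
  have h1 := conMin_le_of_isWide hn h
  refine M_eq_of_conMin_le_low ((conMin_le_of_le (P.chain 0 hn)).trans h1) h1 ?_
  rintro h'
  simp [Entry.IsWide, h'] at h

theorem M_low_eq_of_isWide {i j : ℕ} (hn : 1 ≤ n) (hi : (P.M 0 i).IsWide)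
    (hj : (P.M 1 j).IsWide) : P.M 0 i = P.M 1 j := by
  refine M_eq_of_conMin_le_low (conMin_le_of_isWide (Nat.zero_le _) hi)
    (conMin_le_of_isWide hn hj) ?_
  rintro h'
  simp [Entry.IsWide, h'] at hj

theorem isWide_eq {q i j : ℕ} (hq : q ≤ n) (hi : (P.M q i).IsWide) (hj : (P.M q j).IsWide) :
    P.M q i = P.M q j :=
  M_eq_of_rel hq (rel_of_isWide hq hi hj)

/-- Every `μ` in row `0` has a matching `μ` in row `1`. -/
theorem exists_matching_row_one {i : ℕ} (h : P.M 0 i = .mu) : ∃ j, P.M 1 j = .mu ∧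
    P.θ 0 (i + 1) j ∧ (((i : ℕ∞) < conMin (P.θ 0) ∧ (j : ℕ∞) < conMin (P.θ 1)) ∨
      (conMin (P.θ 0) ≤ (i : ℕ∞) ∧ conMin (P.θ 1) ≤ (j : ℕ∞))) := by
  rcases P.lowRows with h' | ⟨a, h0, h1, ζ, hζ, r0, r1⟩ | ⟨m, h0, ξ, hξ, r0, r1⟩ |
      ⟨m, d, hd, h0, h1, ξ, hξ, r0, r1⟩ | ⟨a, m, d, hd, h0, h1, ha, ζ, ξ, hζ, hξ, r0, r1⟩ |
      ⟨m, l, d, hd, h0, h1, hl, ζ, ξ, hζ, hξ, r0, r1⟩ |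
      ⟨m, l, d, hd, h0, h1, hm, hl, hmod, ξ, hξ, r0, r1⟩
  · simp [(h' i).1] at h
  · refine ⟨i + 1, ?_, (P.θ 0).refl _, by simp [h0, h1, conMin_bot, -Nat.cast_add]⟩
    rw [r0] at h
    split_ifs at h with hi
    rw [r1, if_neg (by omega), if_neg (by omega)]
  · rw [r0] at h
    rcases hξ with rfl | rfl | rfl <;> split_ifs at h
  · simp only [h0, h1, conMin_natCon hd, Nat.cast_le, Nat.cast_lt]
    rw [r0] at h
    split_ifs at h with hi
    exact ⟨i + 1, by rw [r1, if_neg (by omega), h], (natCon m d).refl _, by omega⟩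
  · simp only [h0, h1, conMin_natCon hd, Nat.cast_le, Nat.cast_lt]
    refine ⟨i + 1, ?_, (natCon m d).refl _, by omega⟩
    rw [r0] at h
    rw [r1, if_neg, if_neg]
    · split_ifs at h ⊢ <;> first | rfl | exact h | omega
    · rintro rfl
      simp at h
    · intro hi
      rw [if_pos (by omega)] at h
      cases h
  · simp only [h0, h1, conMin_natCon hd, Nat.cast_le, Nat.cast_lt]
    rw [r0] at h
    split_ifs at h with hi
    -- Adding the multiple `l * d` of the period carries the position past `l` within its class
    -- modulo `d`.
    have : l ≤ l * d := Nat.le_mul_of_pos_right l hd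
    refine ⟨i + 1 + l * d, ?_, Or.inr ⟨by omega, by omega, by simp [Nat.ModEq]⟩, by omega⟩
    rw [r1, if_neg (by omega), if_neg (by omega), h]
  · simp only [h0, h1, conMin_natCon hd, Nat.cast_le, Nat.cast_lt]
    rw [r0] at h
    split_ifs at h with h2 h3
    · refine ⟨l - 1, ?_, Or.inr ⟨by omega, by omega, ?_⟩, by omega⟩
      · rw [r1, if_neg (by omega), if_pos (by omega)]
      · rw [h3]; exact hmod.symm
    · have : l ≤ l * d := Nat.le_mul_of_pos_right l hd
      refine ⟨i + 1 + l * d, ?_, Or.inr ⟨by omega, by omega, by simp [Nat.ModEq]⟩, by omega⟩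
      rw [r1, if_neg (by omega), if_neg (by omega), h]

/-- Every `μ` in row `1` from position `min θ_1` on has a matching `μ` in row `0`. -/
theorem exists_matching_row_zero {i : ℕ} (h : P.M 1 i = .mu) (hi : conMin (P.θ 1) ≤ (i : ℕ∞)) :
    ∃ j, P.M 0 j = .mu ∧ P.θ 0 (j + 1) i ∧ conMin (P.θ 0) ≤ (j : ℕ∞) := by
  have hne : P.θ 1 ≠ ⊥ := by
    intro h'
    simp [h', conMin_bot] at hi
  rcases P.lowRows with h' | ⟨a, h0, h1, ζ, hζ, r0, r1⟩ | ⟨m, h0, ξ, hξ, r0, r1⟩ |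
      ⟨m, d, hd, h0, h1, ξ, hξ, r0, r1⟩ | ⟨a, m, d, hd, h0, h1, ha, ζ, ξ, hζ, hξ, r0, r1⟩ |
      ⟨m, l, d, hd, h0, h1, hl, ζ, ξ, hζ, hξ, r0, r1⟩ |
      ⟨m, l, d, hd, h0, h1, hm, hl, hmod, ξ, hξ, r0, r1⟩
  · simp [(h' i).2] at h
  · exact absurd h1 hne
  · simp [r1] at h
  all_goals
    simp only [h0, h1, conMin_natCon hd, Nat.cast_le] at hi ⊢
    -- The position `i - 1` could fall below `m`; adding one period avoids this.
    refine ⟨i + d - 1, ?_, ?_, by omega⟩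
    · rw [r1] at h
      rw [r0]
      split_ifs at h ⊢ <;> first | exact h | omega
    · rw [Nat.sub_add_cancel (by omega)]
      exact Or.inr ⟨by omega, by omega, by simp [Nat.ModEq]⟩

theorem MuIn.spec {a b : ℕ} (h : P.MuIn a b) : P.M 0 a = .mu ∧ P.M 1 b = .mu ∧
    P.θ 0 (a + 1) b ∧ (a : ℕ∞) < conMin (P.θ 0) ∧ (b : ℕ∞) < conMin (P.θ 1) := by
  rcases h with ⟨⟨h0, h1, ζ, hζ, r0, r1⟩, rfl⟩ |
    ⟨m, d, ⟨hd, h0, h1, ha, ζ, ξ, hζ, hξ, r0, r1⟩, rfl⟩ |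
    ⟨m, l, d, ⟨hd, h0, h1, hm, hl, hmod, ξ, hξ, r0, r1⟩, rfl, rfl⟩
  · refine ⟨by rw [r0, if_neg (lt_irrefl _)], by rw [r1, if_neg (by omega), if_neg (by omega)],
      (P.θ 0).refl _, ?_, ?_⟩
    · rw [h0, conMin_bot]; exact ENat.natCast_lt_top _
    · rw [h1, conMin_bot]; exact ENat.natCast_lt_top _
  · simp only [h0, h1, conMin_natCon hd, Nat.cast_lt]
    refine ⟨by rw [r0, if_neg (lt_irrefl _), if_pos ha], ?_, (natCon m d).refl _, ha, by omega⟩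
    rw [r1, if_neg (by omega), if_neg (by omega), if_pos (by omega)]
  · simp only [h0, h1, conMin_natCon hd, Nat.cast_lt]
    refine ⟨by rw [r0, if_neg (by omega), if_pos (by omega)],
      by rw [r1, if_neg (by omega), if_pos (by omega)], ?_, by omega, by omega⟩
    rw [Nat.sub_add_cancel hm]
    exact Or.inr ⟨le_rfl, by omega, hmod.symm⟩

/-- Matching `μ`s before the positions `min θ_q` come from the initial ones by a shift. -/
theorem exists_muIn {i j : ℕ} (hi : P.M 0 i = .mu) (hj : P.M 1 j = .mu)
    (hi' : (i : ℕ∞) < conMin (P.θ 0)) (hj' : (j : ℕ∞) < conMin (P.θ 1)) (h : P.θ 0 (i + 1) j) :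
    ∃ a b, P.MuIn a b ∧ (j : ℤ) - i = (b : ℤ) - a ∧ a ≤ i ∧ b ≤ j := by
  rcases P.lowRows with h' | ⟨a, H⟩ | ⟨m, h0, ξ, hξ, r0, r1⟩ |
      ⟨m, d, hd, h0, h1, ξ, hξ, r0, r1⟩ | ⟨a, m, d, H⟩ |
      ⟨m, l, d, hd, h0, h1, hl, ζ, ξ, hζ, hξ, r0, r1⟩ | ⟨m, l, d, H⟩
  · simp [(h' i).1] at hi
  · refine ⟨a, a + 1, Or.inl ⟨H, rfl⟩, ?_⟩
    obtain ⟨h0, h1, ζ, hζ, r0, r1⟩ := H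
    rw [h0, bot_con_iff] at h
    rw [r0] at hi
    split_ifs at hi
    omega
  · simp [r1] at hj
  · simp only [h0, conMin_natCon hd, Nat.cast_lt] at hi'
    simp [r0, hi'] at hi
  · refine ⟨a, a + 1, Or.inr (Or.inl ⟨m, d, H, rfl⟩), ?_⟩
    obtain ⟨hd, h0, h1, ha, ζ, ξ, hζ, hξ, r0, r1⟩ := H
    simp only [h0, h1, conMin_natCon hd, Nat.cast_lt] at hi' hj'
    have hai : a ≤ i := by
      by_contra hlt
      rw [r0, if_pos (by omega)] at hi
      cases hi
    rw [h0] at h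
    -- In the second case `i < m` and `j < m + 1` force `i + 1` and `j` both to be `m`, so `j = i +
    -- 1` there too.
    rcases h with h | ⟨h2, h3, -⟩ <;> omega
  · simp only [h0, conMin_natCon hd, Nat.cast_lt] at hi'
    simp [r0, hi'] at hi
  · refine ⟨m - 1, l - 1, Or.inr (Or.inr ⟨m, l, d, H, rfl, rfl⟩), ?_⟩
    obtain ⟨hd, h0, h1, hm, hl, hmod, ξ, hξ, r0, r1⟩ := H
    simp only [h0, h1, conMin_natCon hd, Nat.cast_lt] at hi' hj'
    -- In this type each of the two rows has a single `μ` before its minimum, in the last position.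
    have hai : ¬ i + 1 < m := by
      intro hlt
      rw [r0, if_pos hlt] at hi
      cases hi
    have hbj : ¬ j + 1 < l := by
      intro hlt
      rw [r1, if_pos hlt] at hj
      cases hj
    omega

/-- Positions of rows `0` and `1` that differ by the shift of the initial `μ`s. -/
theorem MuIn.shift {a b i j : ℕ} (h : P.MuIn a b) (hij : (j : ℤ) - i = (b : ℤ) - a)
    (hi : P.M 0 i ≠ .delta) :
    (P.M 0 i = .mu ∧ P.M 1 j = .mu ∧ (i : ℕ∞) < conMin (P.θ 0) ∧ (j : ℕ∞) < conMin (P.θ 1)) ∨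
    (conMin (P.θ 0) ≤ (i : ℕ∞) ∧ conMin (P.θ 1) ≤ (j : ℕ∞)) := by
  rcases h with ⟨⟨h0, h1, ζ, hζ, r0, r1⟩, rfl⟩ |
    ⟨m, d, ⟨hd, h0, h1, ha, ζ, ξ, hζ, hξ, r0, r1⟩, rfl⟩ |
    ⟨m, l, d, ⟨hd, h0, h1, hm, hl, hmod, ξ, hξ, r0, r1⟩, rfl, rfl⟩
  · rw [r0] at hi ⊢
    split_ifs at hi ⊢
    · exact absurd rfl hi
    · refine Or.inl ⟨rfl, by rw [r1, if_neg (by omega), if_neg (by omega)], ?_, ?_⟩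
      · rw [h0, conMin_bot]; exact ENat.natCast_lt_top _
      · rw [h1, conMin_bot]; exact ENat.natCast_lt_top _
  · simp only [h0, h1, conMin_natCon hd, Nat.cast_lt, Nat.cast_le]
    have hai : a ≤ i := by
      by_contra hlt
      rw [r0, if_pos (by omega)] at hi
      exact hi rfl
    by_cases him : i < m
    · refine Or.inl ⟨by rw [r0, if_neg (by omega), if_pos him], ?_, him, by omega⟩
      rw [r1, if_neg (by omega), if_neg (by omega), if_pos (by omega)]
    · exact Or.inr (by omega)
  · simp only [h0, h1, conMin_natCon hd, Nat.cast_lt, Nat.cast_le]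
    have hai : ¬ i + 1 < m := by
      intro hlt
      rw [r0, if_pos hlt] at hi
      exact hi rfl
    by_cases him : i + 1 = m
    · refine Or.inl ⟨by rw [r0, if_neg (by omega), if_pos him],
        by rw [r1, if_neg (by omega), if_pos (by omega)], by omega, by omega⟩
    · exact Or.inr (by omega)

end CPair

theorem Partn.rank_le {n : ℕ} (α : Partn n) : α.rank ≤ n := by
  have key : ∀ C ∈ α.transversals, ∃ x : Fin n, Sum.inl x ∈ C := fun C hC => hC.2.1
  rcases Nat.eq_zero_or_pos n with rfl | hn
  · rw [Partn.rank_eq_zero fun x => x.elim0]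
  have : Nonempty (Fin n) := ⟨⟨0, hn⟩⟩
  choose! f hf using key
  calc α.rank ≤ (Set.univ : Set (Fin n)).ncard := by
        refine Set.ncard_le_ncard_of_injOn f (fun _ _ => Set.mem_univ _) ?_ (Set.toFinite _)
        intro C hC D hD h
        exact Setoid.eq_of_mem_classes hC.1 (hf C hC) hD.1 (h ▸ hf D hD)
    _ = n := by rw [Set.ncard_univ, Nat.card_fin]

theorem greenR_refl {M : Type*} [Mul M] (x : M) : GreenR x x := rfl

theorem greenL_refl {M : Type*} [Mul M] (x : M) : GreenL x x := rfl

namespace CPair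

open Partn

variable {n : ℕ} {P Q : CPair n}

/-! ### Membership in `cg` -/

/-- The condition imposed by the relation `cg` on pairs with a given common matrix entry. -/
def Cond (P : CPair n) (i j : ℕ) (α β : Partn n) : Entry → Prop
  | .delta => P.θ α.rank i j ∧ α = β
  | .R => True
  | .N q H => q = α.rank ∧ P.θ α.rank i j ∧ GreenH α β ∧ ∃ π ∈ H, PermDiff α β π
  | .lam => GreenL α.hat β.hat
  | .rho => GreenR α.hat β.hat
  | .muDown => α.hat = β.hat ∧ GreenL α β
  | .muUp => α.hat = β.hat ∧ GreenR α β
  | .mu => α.hat = β.hat ∧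
      ((α.rank = β.rank ∧ P.θ α.rank i j) ∨
       (α.rank ≠ β.rank ∧ P.θ 0 (i + β.rank) (j + α.rank) ∧
         (((i : ℕ∞) < conMin (P.θ α.rank) ∧ (j : ℕ∞) < conMin (P.θ β.rank)) ∨
          (conMin (P.θ α.rank) ≤ (i : ℕ∞) ∧ conMin (P.θ β.rank) ≤ (j : ℕ∞)))))

/-- Turns the disjunction over symbols into a common entry and a condition depending on it, so that
membership is settled by rewriting the entry. -/
theorem mem_cg_iff {i j : ℕ} {α β : Partn n} :
    ((⟨i, α⟩, ⟨j, β⟩) : TwistedPartn n × TwistedPartn n) ∈ P.cg ↔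
      P.M α.rank i = P.M β.rank j ∧ P.Cond i j α β (P.M α.rank i) := by
  constructor
  · rintro ⟨i', j', α', β', q, r, hp, rfl, rfl, h⟩
    simp only [Prod.mk.injEq, TwistedPartn.mk.injEq] at hp
    obtain ⟨⟨rfl, rfl⟩, rfl, rfl⟩ := hp
    rcases h with ⟨h1, h2, h⟩ | ⟨h1, h2⟩ | ⟨H, h1, h2, h⟩ | ⟨h1, h2, h⟩ | ⟨h1, h2, h⟩ |
      ⟨h1, h2, h⟩ | ⟨h1, h2, h⟩ | ⟨h1, h2, h, h'⟩
    all_goals rw [h1, h2]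
    · exact ⟨rfl, h⟩
    · exact ⟨rfl, trivial⟩
    · exact ⟨rfl, rfl, h⟩
    · exact ⟨rfl, h⟩
    · exact ⟨rfl, h⟩
    · exact ⟨rfl, h⟩
    · exact ⟨rfl, h⟩
    · refine ⟨rfl, h, ?_⟩
      rcases h' with h' | ⟨h3, h4, h'⟩ | ⟨h3, h4, h'⟩
      · exact Or.inl h'
      · exact Or.inr ⟨h3, h4, Or.inl h'⟩
      · exact Or.inr ⟨h3, h4, Or.inr h'⟩
  · rintro ⟨h1, h⟩
    refine ⟨i, j, α, β, _, _, rfl, rfl, rfl, ?_⟩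
    cases hs : P.M α.rank i <;> rw [hs] at h1 h
    · exact Or.inl ⟨rfl, h1.symm, h⟩
    · exact Or.inr <| Or.inr <| Or.inr <| Or.inr <| Or.inr <| Or.inr <| Or.inl ⟨rfl, h1.symm, h⟩
    · exact Or.inr <| Or.inr <| Or.inr <| Or.inr <| Or.inr <| Or.inl ⟨rfl, h1.symm, h⟩
    · refine Or.inr <| Or.inr <| Or.inr <| Or.inr <| Or.inr <| Or.inr <| Or.inr
        ⟨rfl, h1.symm, h.1, ?_⟩
      rcases h.2 with h' | ⟨h3, h4, h' | h'⟩
      · exact Or.inl h'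
      · exact Or.inr (Or.inl ⟨h3, h4, h'⟩)
      · exact Or.inr (Or.inr ⟨h3, h4, h'⟩)
    · exact Or.inr <| Or.inr <| Or.inr <| Or.inl ⟨rfl, h1.symm, h⟩
    · exact Or.inr <| Or.inr <| Or.inr <| Or.inr <| Or.inl ⟨rfl, h1.symm, h⟩
    · exact Or.inr <| Or.inl ⟨rfl, h1.symm⟩
    · obtain ⟨rfl, h⟩ := h
      exact Or.inr <| Or.inr <| Or.inl ⟨_, rfl, h1.symm, h⟩

theorem N_index {q p i : ℕ} {H : Subgroup (Equiv.Perm (Fin p))} (hq : q ≤ n)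
    (h : P.M q i = .N p H) : p = q ∧ 2 ≤ q := by
  rcases eq_zero_or_one_or hq with rfl | rfl | ⟨h2, -⟩
  · have := P.row_zero i
    simp [h, Entry.IsWide] at this
  · have := P.row_one i
    simp [h, Entry.IsWide] at this
  · rcases P.row_ge_two h2 hq i with h' | ⟨H', h', -⟩ | h'
    · rw [h] at h'; cases h'
    · rw [h] at h'
      injection h' with h' _
      exact ⟨h', h2⟩
    · rw [h] at h'; cases h'

theorem arrow_index {q i : ℕ} (hq : q ≤ n) (h : P.M q i = .muUp ∨ P.M q i = .muDown) : q = 1 := by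
  rcases eq_zero_or_one_or hq with rfl | rfl | ⟨h2, -⟩
  · have := P.row_zero i
    rcases h with h | h <;> simp [h, Entry.IsWide] at this
  · rfl
  · rcases P.row_ge_two h2 hq i with h' | ⟨H', h', -⟩ | h' <;> simp [h'] at h

theorem low_index {q i : ℕ} (hq : q ≤ n) (h : P.M q i = .mu ∨ P.M q i = .lam ∨ P.M q i = .rho) :
    q = 0 ∨ q = 1 := by
  rcases eq_zero_or_one_or hq with rfl | rfl | ⟨h2, -⟩
  · exact Or.inl rfl
  · exact Or.inr rfl
  · rcases P.row_ge_two h2 hq i with h' | ⟨H', h', -⟩ | h' <;> simp [h'] at h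

/-- Related positions of a row carry the same symbol, and every symbol's condition then holds for
equal partitions. These are the test pairs that recover `θ_q`. -/
theorem mem_cg_self {i j : ℕ} {α : Partn n} (h : P.θ α.rank i j) :
    ((⟨i, α⟩, ⟨j, α⟩) : TwistedPartn n × TwistedPartn n) ∈ P.cg := by
  refine mem_cg_iff.2 ⟨M_eq_of_rel α.rank_le h, ?_⟩
  cases hs : P.M α.rank i with
  | N q H =>
    obtain ⟨rfl, -⟩ := N_index α.rank_le hs
    exact ⟨rfl, h, ⟨rfl, rfl⟩, 1, H.one_mem, permDiff_refl rfl⟩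
  | delta => exact ⟨h, rfl⟩
  | muUp => exact ⟨rfl, rfl⟩
  | muDown => exact ⟨rfl, rfl⟩
  | mu => exact ⟨rfl, Or.inl ⟨rfl, h⟩⟩
  | lam => exact rfl
  | rho => exact rfl
  | R => trivial

/-- In pairs of `cg` with equal ranks the numbers of floating components are `θ_q`-related. -/
theorem rel_of_mem_cg {i j : ℕ} {α β : Partn n} (hr : β.rank = α.rank)
    (h : ((⟨i, α⟩, ⟨j, β⟩) : TwistedPartn n × TwistedPartn n) ∈ P.cg) : P.θ α.rank i j := by
  obtain ⟨h1, h⟩ := mem_cg_iff.1 h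
  rw [hr] at h1
  have wide : (P.M α.rank i).IsWide → P.θ α.rank i j := fun hs =>
    rel_of_isWide α.rank_le hs (h1 ▸ hs)
  have arrow : (P.M α.rank i = .muUp ∨ P.M α.rank i = .muDown) → P.θ α.rank i j := by
    intro hs
    have hq := arrow_index α.rank_le hs
    have hs' := hs
    rw [h1] at hs'
    rw [hq] at hs hs'
    rw [row_one_arrow_unique hs hs']
    exact (P.θ _).refl _
  cases hs : P.M α.rank i with
  | N q H => rw [hs] at h; exact h.2.1
  | delta => rw [hs] at h; exact h.1
  | muUp => exact arrow (Or.inl hs)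
  | muDown => exact arrow (Or.inr hs)
  | mu =>
    rw [hs] at h
    rcases h.2 with h | ⟨h, -⟩
    · exact h.2
    · exact absurd hr.symm h
  | lam => exact wide (Or.inl hs)
  | rho => exact wide (Or.inr (Or.inl hs))
  | R => exact wide (Or.inr (Or.inr hs))

theorem isWide_eq_of_low {q r i j : ℕ} (hn : 1 ≤ n) (hq : q = 0 ∨ q = 1) (hr : r = 0 ∨ r = 1)
    (hi : (P.M q i).IsWide) (hj : (P.M r j).IsWide) : P.M q i = P.M r j := by
  rcases hq with rfl | rfl <;> rcases hr with rfl | rfl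
  · exact isWide_eq (Nat.zero_le n) hi hj
  · exact M_low_eq_of_isWide hn hi hj
  · exact (M_low_eq_of_isWide hn hj hi).symm
  · exact isWide_eq hn hi hj

theorem isWide_or_mu {s : Entry} (h : Entry.LEC .mu s) : s = .mu ∨ s.IsWide := by
  cases h <;> simp [Entry.IsWide]

theorem lec_mu {s : Entry} (h : s = .mu ∨ s.IsWide) : Entry.LEC .mu s := by
  rcases h with rfl | rfl | rfl | rfl
  · exact .refl _
  · exact .mu_lam
  · exact .mu_rho
  · exact .top _

/-- Lets pairs of ranks 1 and 0 be reduced to ranks 0 and 1. -/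
theorem mem_cg_symm {a b : TwistedPartn n} (h : (a, b) ∈ P.cg) (hs : P.M a.part.rank a.fl = .mu) :
    (b, a) ∈ P.cg := by
  obtain ⟨i, α⟩ := a
  obtain ⟨j, β⟩ := b
  obtain ⟨h1, h⟩ := mem_cg_iff.1 h
  simp only at hs
  rw [hs] at h1 h
  refine mem_cg_iff.2 ⟨by rw [hs, h1], ?_⟩
  rw [← h1]
  refine ⟨h.1.symm, ?_⟩
  rcases h.2 with ⟨h2, h3⟩ | ⟨h2, h3, h4⟩
  · exact Or.inl ⟨h2.symm, h2 ▸ (P.θ _).symm h3⟩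
  · exact Or.inr ⟨h2.symm, (P.θ 0).symm h3, by tauto⟩

/-- The conditions under which matching `μ`s of `P` give related elements in `cg Q`. -/
theorem mem_cg_of_matching (hn : 1 ≤ n) (hPQ : P.Compares Q) {i j : ℕ} {α β : Partn n}
    (hα : α.rank = 0) (hβ : β.rank = 1) (hat : α.hat = β.hat) (hi : P.M 0 i = .mu)
    (hj : P.M 1 j = .mu) (hij : P.θ 0 (i + 1) j)
    (h : ((i : ℕ∞) < conMin (P.θ 0) ∧ (j : ℕ∞) < conMin (P.θ 1)) ∨
      (conMin (P.θ 0) ≤ (i : ℕ∞) ∧ conMin (P.θ 1) ≤ (j : ℕ∞))) :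
    ((⟨i, α⟩, ⟨j, β⟩) : TwistedPartn n × TwistedPartn n) ∈ Q.cg := by
  obtain ⟨⟨hθ, hM⟩, hb⟩ := hPQ
  have hi' : Q.M 0 i = .mu ∨ (Q.M 0 i).IsWide := isWide_or_mu (hi ▸ hM 0 (Nat.zero_le n) i)
  have hj' : Q.M 1 j = .mu ∨ (Q.M 1 j).IsWide := isWide_or_mu (hj ▸ hM 1 hn j)
  -- The danger is that `Q` has one position before its minimum and the other past it. For a match
  -- before the minima of `P`, condition (b) excludes this; for one past them, the minima of `Q` are
  -- no larger.
  have key : (Q.M 0 i = .mu ∧ Q.M 1 j = .mu ∧ (i : ℕ∞) < conMin (Q.θ 0) ∧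
      (j : ℕ∞) < conMin (Q.θ 1)) ∨
      (conMin (Q.θ 0) ≤ (i : ℕ∞) ∧ conMin (Q.θ 1) ≤ (j : ℕ∞)) := by
    rcases h with ⟨h0, h1⟩ | ⟨h0, h1⟩
    · obtain ⟨a, b, hab, hd, hai, hbj⟩ := exists_muIn hi hj h0 h1 hij
      rcases hb a b hab with ⟨h2, h3⟩ | ⟨a', b', hab', hd'⟩
      · exact Or.inr ⟨h2.trans (by exact_mod_cast hai), h3.trans (by exact_mod_cast hbj)⟩
      · refine MuIn.shift hab' (hd.trans hd'.symm) ?_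
        rcases hi' with hi' | hi'
        · simp [hi']
        · rintro h'
          simp [h', Entry.IsWide] at hi'
    · exact Or.inr ⟨(conMin_le_of_le (hθ 0 (Nat.zero_le n))).trans h0, (conMin_le_of_le (hθ 1 hn)).trans h1⟩
  have heq : Q.M 0 i = Q.M 1 j := by
    rcases key with ⟨h0, h1, -⟩ | ⟨h0, h1⟩
    · rw [h0, h1]
    · refine M_eq_of_conMin_le_low h0 h1 ?_
      rcases hj' with hj' | hj'
      · simp [hj']
      · rintro h'
        simp [h', Entry.IsWide] at hj'
  refine mem_cg_iff.2 ⟨by rw [hα, hβ, heq], ?_⟩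
  rw [hα]
  rcases hi' with hs | hs | hs | hs <;> rw [hs]
  · refine ⟨hat, Or.inr ⟨by omega, ?_, ?_⟩⟩
    · rw [hα, hβ]
      exact hθ 0 (Nat.zero_le n) hij
    · rw [hα, hβ]
      rcases key with ⟨-, -, h⟩ | h
      · exact Or.inl h
      · exact Or.inr h
  · show GreenL α.hat β.hat
    rw [hat]
    rfl
  · show GreenR α.hat β.hat
    rw [hat]
    rfl
  · trivial

/-- Only pairs of different ranks with entry `μ` use condition (b); every other case follows from
the comparison of congruences and entries. -/
theorem cg_subset_of_compares (hn : 1 ≤ n) (hPQ : P.Compares Q) : P.cg ⊆ Q.cg := by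
  rintro ⟨⟨i, α⟩, ⟨j, β⟩⟩ hp
  obtain ⟨h1, h⟩ := mem_cg_iff.1 hp
  have hQi := hPQ.1.2 _ α.rank_le i
  have hQj := hPQ.1.2 _ β.rank_le j
  rw [← h1] at hQj
  have arrow : (P.M α.rank i = .muUp ∨ P.M α.rank i = .muDown) → α.rank = β.rank ∧ i = j := by
    intro hs
    have hα := arrow_index α.rank_le hs
    have hs' := hs
    rw [h1] at hs'
    have hβ := arrow_index β.rank_le hs'
    rw [hα] at hs
    rw [hβ] at hs'
    exact ⟨hα.trans hβ.symm, row_one_arrow_unique hs hs'⟩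
  cases hs : P.M α.rank i with
  | delta =>
    rw [hs] at h
    obtain ⟨h, rfl⟩ := h
    exact mem_cg_self (hPQ.1.1 _ α.rank_le h)
  | R =>
    rw [hs] at hQi hQj
    have hR : ∀ {s : Entry}, Entry.LEC .R s → s = .R := by
      intro s h
      cases h <;> rfl
    refine mem_cg_iff.2 ⟨(hR hQi).trans (hR hQj).symm, ?_⟩
    rw [hR hQi]
    trivial
  | N q H =>
    rw [hs] at h h1 hQi
    obtain ⟨rfl, hθ, hH, π, hπ, hd⟩ := h
    obtain ⟨hr, -⟩ := N_index β.rank_le h1.symm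
    have hθ' := hPQ.1.1 _ α.rank_le hθ
    refine mem_cg_iff.2 ⟨hr ▸ M_eq_of_rel α.rank_le hθ', ?_⟩
    generalize Q.M α.rank i = s at hQi
    cases hQi with
    | refl => exact ⟨rfl, hθ', hH, π, hπ, hd⟩
    | top => trivial
    | N hle => exact ⟨rfl, hθ', hH, π, hle hπ, hd⟩
  | lam =>
    rw [hs] at h h1 hQi hQj
    have hα := low_index α.rank_le (Or.inr (Or.inl hs))
    have hβ := low_index β.rank_le (Or.inr (Or.inl h1.symm))
    have hL : ∀ {s : Entry}, Entry.LEC .lam s → s = .lam ∨ s = .R := by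
      intro s h
      cases h <;> simp
    refine mem_cg_iff.2 ⟨isWide_eq_of_low hn hα hβ ?_ ?_, ?_⟩
    · rcases hL hQi with h | h <;> simp [Entry.IsWide, h]
    · rcases hL hQj with h | h <;> simp [Entry.IsWide, h]
    · rcases hL hQi with h' | h' <;> rw [h']
      · exact h
      · trivial
  | rho =>
    rw [hs] at h h1 hQi hQj
    have hα := low_index α.rank_le (Or.inr (Or.inr hs))
    have hβ := low_index β.rank_le (Or.inr (Or.inr h1.symm))
    have hL : ∀ {s : Entry}, Entry.LEC .rho s → s = .rho ∨ s = .R := by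
      intro s h
      cases h <;> simp
    refine mem_cg_iff.2 ⟨isWide_eq_of_low hn hα hβ ?_ ?_, ?_⟩
    · rcases hL hQi with h | h <;> simp [Entry.IsWide, h]
    · rcases hL hQj with h | h <;> simp [Entry.IsWide, h]
    · rcases hL hQi with h' | h' <;> rw [h']
      · exact h
      · trivial
  | muUp =>
    obtain ⟨hr, rfl⟩ := arrow (Or.inl hs)
    rw [hs] at h hQi
    refine mem_cg_iff.2 ⟨by rw [hr], ?_⟩
    generalize Q.M α.rank i = s at hQi
    cases hQi with
    | refl => exact h
    | top => trivial
    | muUp_mu => exact ⟨h.1, Or.inl ⟨hr, (Q.θ _).refl _⟩⟩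
    | muUp_lam => exact congrArg (fun γ => Set.range fun z => z * γ) h.1
    | muUp_rho => exact congrArg (fun γ => Set.range fun z => γ * z) h.1
  | muDown =>
    obtain ⟨hr, rfl⟩ := arrow (Or.inr hs)
    rw [hs] at h hQi
    refine mem_cg_iff.2 ⟨by rw [hr], ?_⟩
    generalize Q.M α.rank i = s at hQi
    cases hQi with
    | refl => exact h
    | top => trivial
    | muDown_mu => exact ⟨h.1, Or.inl ⟨hr, (Q.θ _).refl _⟩⟩
    | muDown_lam => exact congrArg (fun γ => Set.range fun z => z * γ) h.1
    | muDown_rho => exact congrArg (fun γ => Set.range fun z => γ * z) h.1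
  | mu =>
    rw [hs] at h h1 hQi
    have hα := low_index α.rank_le (Or.inl hs)
    have hβ := low_index β.rank_le (Or.inl h1.symm)
    obtain ⟨hat, ⟨hr, hθ⟩ | ⟨hr, hθ, hc⟩⟩ := h
    · have hθ' := hPQ.1.1 _ α.rank_le hθ
      refine mem_cg_iff.2 ⟨hr ▸ M_eq_of_rel α.rank_le hθ', ?_⟩
      generalize Q.M α.rank i = s at hQi
      cases hQi with
      | refl => exact ⟨hat, Or.inl ⟨hr, hθ'⟩⟩
      | top => trivial
      | mu_lam => exact congrArg (fun γ => Set.range fun z => z * γ) hat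
      | mu_rho => exact congrArg (fun γ => Set.range fun z => γ * z) hat
    -- As `μ` occurs only in rows 0 and 1, the ranks are 0 and 1 in some order; the order 1, 0 is
    -- reflected to 0, 1.
    · rcases hα with hα | hα <;> rcases hβ with hβ | hβ
      · omega
      · rw [hα] at hs hc hθ
        rw [hβ] at h1 hc hθ
        exact mem_cg_of_matching hn hPQ hα hβ hat hs h1.symm hθ hc
      · rw [hα] at hs hc hθ
        rw [hβ] at h1 hc hθ
        have hm := mem_cg_of_matching hn hPQ hβ hα hat.symm h1.symm hs ((P.θ 0).symm hθ) (by tauto)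
        obtain ⟨h2, h3⟩ := mem_cg_iff.1 hm
        rw [hα, hβ] at h2
        refine mem_cg_iff.2 ⟨by rw [hα, hβ, h2], ?_⟩
        rw [hα, ← h2]
        rw [hβ] at h3
        rcases isWide_or_mu (hα ▸ hQi) with h4 | h4 | h4 | h4
        · have := mem_cg_symm hm (by simp only [hβ, h2, h4])
          have := (mem_cg_iff.1 this).2
          rwa [hα, ← h2] at this
        · rw [h2, h4] at h3 ⊢
          exact h3.symm
        · rw [h2, h4] at h3 ⊢
          exact h3.symm
        · rw [h2, h4]
          trivial
      · omega

end CPair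

namespace CPair

open Partn

variable {n : ℕ} {P Q : CPair n}

/-! ### The inclusion of `cg` implies the combinatorial comparison -/

theorem theta_le_of_cg_subset (h : P.cg ⊆ Q.cg) {q : ℕ} (hq : q ≤ n) : P.θ q ≤ Q.θ q := by
  intro i j hij
  have hr := diag_rank (n := n) hq 1
  have := rel_of_mem_cg rfl (h (mem_cg_self (α := diag (1 : Equiv.Perm (Fin q))) (hr ▸ hij)))
  rwa [hr] at this

theorem singletons_rank : (singletons : Partn n).rank = 0 := rank_eq_zero singletons_not_rel

theorem upperBlock_rank : (upperBlock : Partn n).rank = 0 := rank_eq_zero upperBlock_not_rel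

theorem lowerBlock_rank : (lowerBlock : Partn n).rank = 0 := rank_eq_zero lowerBlock_not_rel

theorem hat_singletons : (singletons : Partn n).hat = singletons := hat_eq_self singletons_not_rel

theorem hat_upperBlock : (upperBlock : Partn n).hat = upperBlock := hat_eq_self upperBlock_not_rel

theorem hat_lowerBlock : (lowerBlock : Partn n).hat = lowerBlock := hat_eq_self lowerBlock_not_rel

theorem singletons_ne_single {x y : Fin n} : singletons ≠ single x y := by
  intro h
  have := congrArg rank h
  rw [singletons_rank, single_rank] at this
  omega

theorem not_greenR_singletons_upperBlock (hn : 2 ≤ n) :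
    ¬ GreenR (singletons : Partn n) upperBlock :=
  not_greenR_upperBlock hn fun _ _ h => Sum.inl.inj h

theorem not_greenL_singletons_lowerBlock (hn : 2 ≤ n) :
    ¬ GreenL (singletons : Partn n) lowerBlock :=
  not_greenL_lowerBlock hn fun _ _ h => Sum.inr.inj h

theorem not_greenR_lowerBlock_upperBlock (hn : 2 ≤ n) :
    ¬ GreenR (lowerBlock : Partn n) upperBlock :=
  not_greenR_upperBlock hn fun _ _ h => Option.some.inj h

theorem not_greenL_upperBlock_lowerBlock (hn : 2 ≤ n) :
    ¬ GreenL (upperBlock : Partn n) lowerBlock :=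
  not_greenL_lowerBlock hn fun _ _ h => Option.some.inj h

/-- The possible row-`0` entries of a C-pair whose `cg` contains a pair of distinct partitions of
rank `0`. -/
theorem row_zero_of_mem_cg {i j : ℕ} {α β : Partn n} (hα : α.rank = 0) (hα' : α.hat = α)
    (hβ' : β.hat = β) (hne : α ≠ β)
    (h : ((⟨i, α⟩, ⟨j, β⟩) : TwistedPartn n × TwistedPartn n) ∈ P.cg) :
    (P.M 0 i = .lam ∧ GreenL α β) ∨ (P.M 0 i = .rho ∧ GreenR α β) ∨ P.M 0 i = .R := by
  obtain ⟨-, h⟩ := mem_cg_iff.1 h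
  rw [hα] at h
  rcases P.row_zero i with h' | h' | h' | h' | h' <;> rw [h'] at h
  · exact absurd h.2 hne
  · refine absurd h.1 ?_
    rwa [hα', hβ']
  · refine Or.inl ⟨h', ?_⟩
    have : GreenL α.hat β.hat := h
    rwa [hα', hβ'] at this
  · refine Or.inr (Or.inl ⟨h', ?_⟩)
    have : GreenR α.hat β.hat := h
    rwa [hα', hβ'] at this
  · exact Or.inr (Or.inr h')

/-- The partitions `singletons` and `single x x` have the same image under `hat` but ranks 0 and 1,
so only a matching pair of `μ`s or one of `λ`, `ρ`, `R` can relate them in `Q`. -/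
theorem mu_matching_of_cg_subset (hn : 1 ≤ n) (h : P.cg ⊆ Q.cg) {i j : ℕ} (hi : P.M 0 i = .mu)
    (hj : P.M 1 j = .mu) (hij : P.θ 0 (i + 1) j)
    (hc : ((i : ℕ∞) < conMin (P.θ 0) ∧ (j : ℕ∞) < conMin (P.θ 1)) ∨
      (conMin (P.θ 0) ≤ (i : ℕ∞) ∧ conMin (P.θ 1) ≤ (j : ℕ∞))) :
    Q.M 0 i = Q.M 1 j ∧ ((Q.M 0 i).IsWide ∨ (Q.M 0 i = .mu ∧ Q.θ 0 (i + 1) j ∧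
      (((i : ℕ∞) < conMin (Q.θ 0) ∧ (j : ℕ∞) < conMin (Q.θ 1)) ∨
      (conMin (Q.θ 0) ≤ (i : ℕ∞) ∧ conMin (Q.θ 1) ≤ (j : ℕ∞))))) := by
  let x : Fin n := ⟨0, hn⟩
  have hp : ((⟨i, singletons⟩, ⟨j, single x x⟩) : TwistedPartn n × TwistedPartn n) ∈ P.cg := by
    refine mem_cg_iff.2 ⟨by rw [singletons_rank, single_rank, hi, hj], ?_⟩
    rw [singletons_rank, hi]
    refine ⟨by rw [hat_singletons, single_hat], Or.inr ?_⟩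
    rw [singletons_rank, single_rank]
    exact ⟨zero_ne_one, hij, hc⟩
  obtain ⟨h1, h2⟩ := mem_cg_iff.1 (h hp)
  rw [singletons_rank, single_rank] at h1
  rw [singletons_rank] at h2
  refine ⟨h1, ?_⟩
  rcases Q.row_zero i with h' | h' | h'
  · rw [h'] at h2
    exact absurd h2.2 singletons_ne_single
  · rw [h'] at h2
    rcases h2.2 with h3 | h3
    · rw [singletons_rank, single_rank] at h3
      exact absurd h3.1 zero_ne_one
    · rw [singletons_rank, single_rank] at h3
      exact Or.inr ⟨h', h3.2.1, h3.2.2⟩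
  · exact Or.inl h'

theorem conPer_eq_one_of_le {θ θ' : AddCon ℕ} {m : ℕ} (hθ : θ = natCon m 1) (h : θ ≤ θ') :
    conPer θ' = 1 ∧ conMin θ' ≤ (m : ℕ∞) := by
  have hne : θ' ≠ ⊥ := by
    rintro rfl
    have : m = m + 1 := h (hθ ▸ natCon_add_right le_rfl)
    omega
  obtain ⟨m', d', hd', rfl⟩ := exists_eq_natCon hne
  rw [hθ] at h
  obtain ⟨h1, h2⟩ := natCon_le_natCon le_rfl h
  rw [conPer_natCon hd', conMin_natCon hd', Nat.dvd_one.1 h2]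
  exact ⟨rfl, by exact_mod_cast h1⟩

/-- A `μ` is tested with its match in row 1. For `n ≥ 2`, `λ` and `ρ` are tested with a pair in just
one of the relations L, R, and `R` with a pair in neither. For `n = 1`, period 1 in `P` passes to
`Q`, and reducedness puts `R` there. -/
theorem row_zero_lec (hn : 1 ≤ n) (hred : n = 1 → P.Reduced ∧ Q.Reduced) (h : P.cg ⊆ Q.cg)
    (i : ℕ) : Entry.LEC (P.M 0 i) (Q.M 0 i) := by
  rcases P.row_zero i with hs | hs | hs
  · rw [hs]
    exact .bot _
  · obtain ⟨j, hj, hij, hc⟩ := exists_matching_row_one hs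
    obtain ⟨-, h2⟩ := mu_matching_of_cg_subset hn h hs hj hij hc
    rw [hs]
    rcases h2 with h2 | h2
    · exact lec_mu (Or.inr h2)
    · exact lec_mu (Or.inl h2.1)
  · rcases hn.eq_or_lt with hn1 | hn2
    · obtain ⟨hP, hQ⟩ := hred hn1.symm
      have hR : Q.M 0 i = .R := by
        obtain ⟨m, hm, hi⟩ := exists_natCon_one (Nat.zero_le _) hs
        obtain ⟨h1, h2⟩ := conPer_eq_one_of_le hm (theta_le_of_cg_subset h (Nat.zero_le _))
        exact hQ.2.2 h1 i (h2.trans (by exact_mod_cast hi))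
      rw [hR]
      exact .top _
    · rcases hs with hs | hs | hs
      · have hp : ((⟨i, singletons⟩, ⟨i, upperBlock⟩) : TwistedPartn n × TwistedPartn n) ∈ P.cg := by
          refine mem_cg_iff.2 ⟨by rw [singletons_rank, upperBlock_rank], ?_⟩
          rw [singletons_rank, hs]
          show GreenL _ _
          rw [hat_singletons, hat_upperBlock]
          exact greenL_singletons_upperBlock
        have hnR := not_greenR_singletons_upperBlock hn2
        rcases row_zero_of_mem_cg singletons_rank hat_singletons hat_upperBlock
          (fun he => hnR (he ▸ greenR_refl _)) (h hp) with ⟨h', -⟩ | ⟨-, h'⟩ | h'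
        · rw [hs, h']
          exact .refl _
        · exact absurd h' hnR
        · rw [h']
          exact .top _
      · have hp : ((⟨i, singletons⟩, ⟨i, lowerBlock⟩) : TwistedPartn n × TwistedPartn n) ∈ P.cg := by
          refine mem_cg_iff.2 ⟨by rw [singletons_rank, lowerBlock_rank], ?_⟩
          rw [singletons_rank, hs]
          show GreenR _ _
          rw [hat_singletons, hat_lowerBlock]
          exact greenR_singletons_lowerBlock
        have hnL := not_greenL_singletons_lowerBlock hn2
        rcases row_zero_of_mem_cg singletons_rank hat_singletons hat_lowerBlock
          (fun he => hnL (he ▸ greenL_refl _)) (h hp) with ⟨-, h'⟩ | ⟨h', -⟩ | h'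
        · exact absurd h' hnL
        · rw [hs, h']
          exact .refl _
        · rw [h']
          exact .top _
      · have hp : ((⟨i, lowerBlock⟩, ⟨i, upperBlock⟩) : TwistedPartn n × TwistedPartn n) ∈ P.cg := by
          refine mem_cg_iff.2 ⟨by rw [lowerBlock_rank, upperBlock_rank], ?_⟩
          rw [lowerBlock_rank, hs]
          trivial
        have hnR := not_greenR_lowerBlock_upperBlock hn2
        have hnL := not_greenL_upperBlock_lowerBlock hn2
        rcases row_zero_of_mem_cg lowerBlock_rank hat_lowerBlock hat_upperBlock
          (fun he => hnR (he ▸ greenR_refl _)) (h hp) with ⟨-, h'⟩ | ⟨-, h'⟩ | h'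
        · exact absurd (Eq.symm h' : GreenL _ _) hnL
        · exact absurd h' hnR
        · rw [h']
          exact .top _

/-- The possible row-`1` entries of a C-pair whose `cg` contains a pair of partitions of
rank `1`. -/
theorem row_one_of_mem_cg {i j : ℕ} {x y x' y' : Fin n}
    (h : ((⟨i, single x y⟩, ⟨j, single x' y'⟩) : TwistedPartn n × TwistedPartn n) ∈ P.cg) :
    (x = x' ∧ y = y') ∨ (P.M 1 i = .muUp ∧ x = x') ∨ (P.M 1 i = .muDown ∧ y = y') ∨
      P.M 1 i = .mu ∨ (P.M 1 i).IsWide := by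
  obtain ⟨-, h⟩ := mem_cg_iff.1 h
  rw [single_rank] at h
  rcases P.row_one i with h' | h' | h' | h' | h'
  · rw [h'] at h
    have hR : GreenR (single x y) (single x' y') := by rw [h.2]; exact greenR_refl _
    have hL : GreenL (single x y) (single x' y') := by rw [h.2]; exact greenL_refl _
    exact Or.inl ⟨single_greenR_iff.1 hR, single_greenL_iff.1 hL⟩
  · rw [h'] at h
    exact Or.inr (Or.inl ⟨h', single_greenR_iff.1 h.2⟩)
  · rw [h'] at h
    exact Or.inr (Or.inr (Or.inl ⟨h', single_greenL_iff.1 h.2⟩))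
  · exact Or.inr (Or.inr (Or.inr (Or.inl h')))
  · exact Or.inr (Or.inr (Or.inr (Or.inr h')))

/-- Each of `λ`, `ρ`, `R` stands under the same symbol in row 0, and a pair of ranks 0 and 1
transfers the comparison from there. The `μ`-symbols are tested by moving the lower end, the upper
end or both ends of the transversal of `single x y`. For `n = 1` no end can move, and a `μ` is
visible only through its match in row 0. -/
theorem row_one_lec (hn : 1 ≤ n) (hred : n = 1 → P.Reduced ∧ Q.Reduced) (h : P.cg ⊆ Q.cg)
    (i : ℕ) : Entry.LEC (P.M 1 i) (Q.M 1 i) := by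
  by_cases hw : (P.M 1 i).IsWide
  · have h0 := row_zero_eq_of_isWide hn hw
    let x : Fin n := ⟨0, hn⟩
    have hp : ((⟨i, singletons⟩, ⟨i, single x x⟩) : TwistedPartn n × TwistedPartn n) ∈ P.cg := by
      refine mem_cg_iff.2 ⟨by rw [singletons_rank, single_rank, h0], ?_⟩
      rw [singletons_rank, h0]
      rcases hw with hw | hw | hw <;> rw [hw]
      · show GreenL _ _
        rw [hat_singletons, single_hat]
        exact greenL_refl _
      · show GreenR _ _
        rw [hat_singletons, single_hat]
        exact greenR_refl _
      · trivial
    have h1 := (mem_cg_iff.1 (h hp)).1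
    rw [singletons_rank, single_rank] at h1
    rw [← h0, ← h1]
    exact row_zero_lec hn hred h i
  rcases hn.eq_or_lt with hn1 | hn2
  · obtain ⟨hP, hQ⟩ := hred hn1.symm
    rcases hP.1 1 i le_rfl with hs | hs | hs
    · rw [hs]
      exact .bot _
    · have hm : ∃ j, P.M 0 j = .mu ∧ P.θ 0 (j + 1) i ∧
          (((j : ℕ∞) < conMin (P.θ 0) ∧ (i : ℕ∞) < conMin (P.θ 1)) ∨
          (conMin (P.θ 0) ≤ (j : ℕ∞) ∧ conMin (P.θ 1) ≤ (i : ℕ∞))) := by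
        rcases lt_or_ge (i : ℕ∞) (conMin (P.θ 1)) with hi | hi
        · obtain ⟨j, h1, h2, h3⟩ := hP.2.1 i hs hi
          exact ⟨j, h1, (P.θ 0).symm h3, Or.inl ⟨h2, hi⟩⟩
        · obtain ⟨j, h1, h2, h3⟩ := exists_matching_row_zero hs hi
          exact ⟨j, h1, h2, Or.inr ⟨h3, hi⟩⟩
      obtain ⟨j, hj, hij, hc⟩ := hm
      obtain ⟨h1, h2⟩ := mu_matching_of_cg_subset hn h hj hs hij hc
      rw [hs, ← h1]
      rcases h2 with h2 | h2
      · exact lec_mu (Or.inr h2)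
      · exact lec_mu (Or.inl h2.1)
    · exact absurd (Or.inr (Or.inr hs)) hw
  · let x : Fin n := ⟨0, hn⟩
    let y : Fin n := ⟨1, hn2⟩
    have hxy : x ≠ y := by simp [x, y]
    have mem : ∀ a b c d : Fin n, P.Cond i i (single a b) (single c d) (P.M 1 i) →
        ((⟨i, single a b⟩, ⟨i, single c d⟩) : TwistedPartn n × TwistedPartn n) ∈ P.cg := by
      intro a b c d hc
      refine mem_cg_iff.2 ⟨by rw [single_rank, single_rank], ?_⟩
      rwa [single_rank]
    rcases P.row_one i with hs | hs | hs | hs | hs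
    · rw [hs]
      exact .bot _
    · have := h (mem x x x y (by
        rw [hs]; exact ⟨by rw [single_hat, single_hat], single_greenR_iff.2 rfl⟩))
      rw [hs]
      rcases row_one_of_mem_cg this with h' | h' | h' | h' | h' | h' | h'
      · exact absurd h'.2 hxy
      · rw [h'.1]; exact .refl _
      · exact absurd h'.2 hxy
      · rw [h']; exact .muUp_mu
      · rw [h']; exact .muUp_lam
      · rw [h']; exact .muUp_rho
      · rw [h']; exact .top _
    · have := h (mem x x y x (by
        rw [hs]; exact ⟨by rw [single_hat, single_hat], single_greenL_iff.2 rfl⟩))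
      rw [hs]
      rcases row_one_of_mem_cg this with h' | h' | h' | h' | h' | h' | h'
      · exact absurd h'.1 hxy
      · exact absurd h'.2 hxy
      · rw [h'.1]; exact .refl _
      · rw [h']; exact .muDown_mu
      · rw [h']; exact .muDown_lam
      · rw [h']; exact .muDown_rho
      · rw [h']; exact .top _
    · have := h (mem x x y y (by
        rw [hs]
        exact ⟨by rw [single_hat, single_hat],
          Or.inl ⟨by rw [single_rank, single_rank], (P.θ _).refl _⟩⟩))
      rw [hs]
      rcases row_one_of_mem_cg this with h' | h' | h' | h' | h'
      · exact absurd h'.1 hxy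
      · exact absurd h'.2 hxy
      · exact absurd h'.2 hxy
      · exact lec_mu (Or.inl h')
      · exact lec_mu (Or.inr h')
    · exact absurd hs hw

/-- For an `N`-symbol, the pairs of `diag 1` and `diag π` with `π ∈ H` exclude `Δ`, as `H` is
non-trivial, and show that `H` lies in the subgroup of `Q`. An `R` extends up to row 0, and a pair
of ranks 0 and `q` carries the comparison back. -/
theorem high_row_lec (h : P.cg ⊆ Q.cg) {q : ℕ} (hq2 : 2 ≤ q) (hq : q ≤ n)
    (i : ℕ) : Entry.LEC (P.M q i) (Q.M q i) := by
  have hr : ∀ π : Equiv.Perm (Fin q), (diag π : Partn n).rank = q := diag_rank hq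
  rcases P.row_ge_two hq2 hq i with hs | ⟨H, hs, hH, hne⟩ | hs
  · rw [hs]
    exact .bot _
  · have hp : ∀ π ∈ H, ((⟨i, diag (1 : Equiv.Perm (Fin q))⟩, ⟨i, diag π⟩) :
        TwistedPartn n × TwistedPartn n) ∈ Q.cg := by
      intro π hπ
      refine h (mem_cg_iff.2 ⟨by rw [hr, hr], ?_⟩)
      rw [hr, hs]
      exact ⟨(hr 1).symm, (P.θ _).refl _, diag_greenH hq 1 π, π, hπ, diag_permDiff hq π⟩
    have hp' := fun π hπ => (mem_cg_iff.1 (hp π hπ)).2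
    simp only [hr] at hp'
    rcases Q.row_ge_two hq2 hq i with hs' | ⟨H', hs', hH', -⟩ | hs'
    · refine absurd ((Subgroup.eq_bot_iff_forall H).2 fun π hπ => ?_) hne
      have h1 := hp' π hπ
      rw [hs'] at h1
      have h2 := diag_permDiff hq π
      rw [← h1.2] at h2
      exact h2.eq_one
    · rw [hs, hs']
      refine .N fun π hπ => ?_
      have h1 := hp' π hπ
      rw [hs'] at h1
      obtain ⟨-, -, -, π', hπ', hd⟩ := h1
      exact PermDiff.mem_of_mem hH' (diag_permDiff hq π) hd hπ'
    · rw [hs']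
      exact .top _
  · have h0 : P.M 0 i = .R := by
      have : ∀ k ≤ n, P.M k i = .R → P.M 0 i = .R := by
        intro k
        induction k with
        | zero => exact fun _ h => h
        | succ k ih =>
          intro hk h
          rcases Nat.eq_zero_or_pos k with rfl | hk0
          · rw [← h]
            exact row_zero_eq_of_isWide hk (Or.inr (Or.inr h))
          · exact ih (by omega) (P.vert2 k i (by omega) hk h)
      exact this q hq hs
    have hp : ((⟨i, singletons⟩, ⟨i, diag (1 : Equiv.Perm (Fin q))⟩) :
        TwistedPartn n × TwistedPartn n) ∈ P.cg := by
      refine mem_cg_iff.2 ⟨by rw [singletons_rank, hr, h0, hs], ?_⟩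
      rw [singletons_rank, h0]
      trivial
    have h1 := (mem_cg_iff.1 (h hp)).1
    rw [singletons_rank, hr] at h1
    have h2 := row_zero_lec (by omega) (by omega) h i
    rw [h0] at h2
    rw [← h1]
    generalize Q.M 0 i = s at h2
    cases h2 <;> exact .top _

theorem compares_of_cg_subset (hn : 1 ≤ n) (hred : n = 1 → P.Reduced ∧ Q.Reduced)
    (h : P.cg ⊆ Q.cg) : P.Compares Q := by
  refine ⟨⟨fun q hq => theta_le_of_cg_subset h hq, fun q hq i => ?_⟩, fun a b hab => ?_⟩
  · rcases eq_zero_or_one_or hq with rfl | rfl | ⟨h2, -⟩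
    · exact row_zero_lec hn hred h i
    · exact row_one_lec hn hred h i
    · exact high_row_lec h h2 hq i
  -- The initial `μ`s are seen by `Q` either past both minima, giving (b1), or as a match before
  -- both, whose shift is that of the initial `μ`s of `Q`, giving (b2).
  · obtain ⟨ha, hb, hθ, ha', hb'⟩ := hab.spec
    obtain ⟨h1, h2 | ⟨h2, h3, h4⟩⟩ := mu_matching_of_cg_subset hn h ha hb hθ (Or.inl ⟨ha', hb'⟩)
    · exact Or.inl ⟨conMin_le_of_isWide (Nat.zero_le _) h2, conMin_le_of_isWide hn (h1 ▸ h2)⟩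
    · rcases h4 with ⟨h4, h5⟩ | h4
      · obtain ⟨a', b', hab', hd, -, -⟩ := exists_muIn h2 (h1 ▸ h2) h4 h5 h3
        exact Or.inr ⟨a', b', hab', hd.symm⟩
      · exact Or.inl h4

/-! ### Exceptional C-pairs -/

theorem mem_cgx_iff {i j : ℕ} {α β : Partn n} :
    ((⟨i, α⟩, ⟨j, β⟩) : TwistedPartn n × TwistedPartn n) ∈ P.cgx ↔
      ((⟨i, α⟩, ⟨j, β⟩) : TwistedPartn n × TwistedPartn n) ∈ P.cg ∨
      ∃ m d, P.ExcRow α.rank m d ∧ β.rank = α.rank ∧ natCon m d i j ∧ ¬ P.θ α.rank i j ∧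
        GreenH α β ∧ ∃ π : Equiv.Perm (Fin α.rank), π ∉ alternatingGroup (Fin α.rank) ∧
          PermDiff α β π := by
  constructor
  · rintro (h | ⟨i', j', α', β', q, m, d, hp, hx, rfl, hr, h⟩)
    · exact Or.inl h
    · simp only [Prod.mk.injEq, TwistedPartn.mk.injEq] at hp
      obtain ⟨⟨rfl, rfl⟩, rfl, rfl⟩ := hp
      exact Or.inr ⟨m, d, hx, hr.symm, h⟩
  · rintro (h | ⟨m, d, hx, hr, h⟩)
    · exact Or.inl h
    · exact Or.inr ⟨i, j, α, β, α.rank, m, d, rfl, hx, rfl, hr.symm, h⟩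

/-- If a pair of `cg P` were an odd pair of `Q`, replacing its second partition by the first would
stay in `cg P`. The new pair has numbers unrelated in `Q`, so it too would have to be odd; but its
permutational difference is the identity. -/
theorem cg_subset_cgx_iff : P.cg ⊆ Q.cgx ↔ P.cg ⊆ Q.cg := by
  refine ⟨?_, fun h => h.trans Set.subset_union_left⟩
  rintro h ⟨⟨i, α⟩, ⟨j, β⟩⟩ hp
  rcases mem_cgx_iff.1 (h hp) with h' | ⟨m, d, hx, hr, hij, hθ, -⟩
  · exact h'
  · rcases mem_cgx_iff.1 (h (mem_cg_self (rel_of_mem_cg hr hp))) with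
      h' | ⟨-, -, -, -, -, -, -, π, hπ, hd⟩
    · exact absurd (rel_of_mem_cg rfl h') hθ
    · rw [hd.eq_one] at hπ
      exact absurd (Subgroup.one_mem _) hπ

theorem M_eq_R_of_le {q q' i : ℕ} (hq' : 1 ≤ q') (hle : q' ≤ q) (hq : q ≤ n)
    (h : P.M q i = .R) : P.M q' i = .R := by
  induction q, hle using Nat.le_induction with
  | base => exact h
  | succ k hk ih => exact ih (by omega) (P.vert2 k i (by omega) hq h)

/-- Below an `N`-symbol all rows `q ≥ 2` carry the symbol `R`. -/
theorem M_eq_R_of_lt {q q' p i : ℕ} {H : Subgroup (Equiv.Perm (Fin p))} (hq' : 2 ≤ q')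
    (hlt : q' < q) (hq : q ≤ n) (h : P.M q i = .N p H) : P.M q' i = .R := by
  obtain ⟨k, rfl⟩ : ∃ k, q = k + 1 := ⟨q - 1, by omega⟩
  obtain ⟨h1, -, -, h2⟩ := P.vert1 k i hq ⟨p, H, h⟩
  refine M_eq_R_of_le (by omega) (Nat.lt_succ_iff.1 hlt) (by omega) ?_
  rcases P.row_ge_two (q := k) (by omega) (by omega) i with h' | ⟨H', h', -⟩ | h'
  · exact absurd h' h1
  · exact absurd ⟨_, _, h'⟩ h2
  · exact h'

/-- An `R` forces period 1, whereas the exceptional period is even. -/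
theorem ExcRow.ne_R {q m d : ℕ} (h : P.ExcRow q m d) (i : ℕ) : P.M q i ≠ .R := by
  intro hR
  obtain ⟨-, hq, hd, hθ, -⟩ := h
  obtain ⟨k, hk, -⟩ := exists_natCon_one hq (Or.inr (Or.inr hR))
  have := (natCon_inj (by omega) le_rfl (hθ.symm.trans hk)).2
  omega

/-- The `N`-symbol in the exceptional row `q' > 2` would force an `R` into the exceptional row `q`.
-/
theorem ExcRow.not_lt {q m d q' m' d' : ℕ} (h : P.ExcRow q m d) (h' : P.ExcRow q' m' d') :
    ¬ q < q' := fun hlt =>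
  h.ne_R m' (M_eq_R_of_lt h.1 hlt h'.2.1 (h'.2.2.2.2.1 (by have := h.1; omega)))

/-- The exceptional row is unique. -/
theorem ExcRow.unique {q m d q' m' d' : ℕ} (h : P.ExcRow q m d) (h' : P.ExcRow q' m' d') :
    q = q' ∧ m = m' ∧ d = d' := by
  have hq : q = q' := le_antisymm (le_of_not_gt (h'.not_lt h)) (le_of_not_gt (h.not_lt h'))
  subst hq
  have := natCon_inj (by have := h.2.2.1; omega) (by have := h'.2.2.1; omega)
    (h.2.2.2.1.symm.trans h'.2.2.2.1)
  exact ⟨rfl, this.1, by omega⟩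

/-- The entries of the exceptional row from position `min θ_q` on. -/
theorem ExcRow.entry {q m d : ℕ} (h : P.ExcRow q m d) {i : ℕ} (hi : m ≤ i) :
    P.M q i = .delta ∨ P.M q i = .N q (alternatingGroup (Fin q)) := by
  obtain ⟨h2, hq, hd, hθ, h3, h4⟩ := h
  have hmin : conMin (P.θ q) = m := by rw [hθ, conMin_natCon (by omega)]
  rw [M_eq_of_conMin_le hq (i := i) (j := m) (by rw [hmin]; exact_mod_cast hi) hmin.le]
  rcases h2.eq_or_lt with rfl | h2
  · exact Or.inl (h4 rfl).1
  · exact Or.inr (h3 h2)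

/-! ### Odd pairs and the inclusions of `cgx` -/

theorem not_natCon_two_mul {m d : ℕ} (hd : 1 ≤ d) : ¬ natCon m (2 * d) m (m + d) := by
  rintro (h | ⟨-, -, h⟩)
  · omega
  · have := (Nat.modEq_iff_dvd' (Nat.le_add_right m d)).1 h
    rw [Nat.add_sub_cancel_left] at this
    have := Nat.le_of_dvd hd this
    omega

theorem ExcRow.mem_cgx {q m d : ℕ} (h : P.ExcRow q m d) {π : Equiv.Perm (Fin q)}
    (hπ : π ∉ alternatingGroup (Fin q)) :
    ((⟨m, diag (1 : Equiv.Perm (Fin q))⟩, ⟨m + d, diag π⟩) :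
      TwistedPartn n × TwistedPartn n) ∈ P.cgx :=
  Or.inr ⟨m, m + d, _, _, q, m, d, rfl, h, (diag_rank h.2.1 1).symm, (diag_rank h.2.1 π).symm,
    natCon_add_right le_rfl, by rw [h.2.2.2.1]; exact not_natCon_two_mul h.2.2.1,
    diag_greenH h.2.1 1 π, π, hπ, diag_permDiff h.2.1 π⟩

theorem exists_notMem_alternatingGroup {q : ℕ} (hq : 2 ≤ q) :
    ∃ τ : Equiv.Perm (Fin q), τ ∉ alternatingGroup (Fin q) := by
  refine ⟨Equiv.swap ⟨0, by omega⟩ ⟨1, by omega⟩, ?_⟩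
  rw [Equiv.Perm.mem_alternatingGroup, Equiv.Perm.sign_swap (by simp)]
  decide

/-- An even permutation is a quotient of two odd ones. -/
theorem eq_top_of_odd_mem {q : ℕ} (hq : 2 ≤ q) {H : Subgroup (Equiv.Perm (Fin q))}
    (h : ∀ π, π ∉ alternatingGroup (Fin q) → π ∈ H) : H = ⊤ := by
  obtain ⟨τ, hτ⟩ := exists_notMem_alternatingGroup hq
  refine (Subgroup.eq_top_iff' H).2 fun π => ?_
  by_cases hπ : π ∈ alternatingGroup (Fin q)
  · have : π * τ ∉ alternatingGroup (Fin q) := fun h' =>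
      hτ ((Subgroup.mul_mem_cancel_left _ hπ).1 h')
    exact (Subgroup.mul_mem_cancel_right _ (h τ hτ)).1 (h _ this)
  · exact h π hπ

theorem ExcRow.cgx_subset_cg_iff {q m d : ℕ} (h : P.ExcRow q m d) :
    P.cgx ⊆ Q.cg ↔ P.cg ⊆ Q.cg ∧ 2 * conPer (Q.θ q) ∣ conPer (P.θ q) ∧
      ∀ i : ℕ, conMin (Q.θ q) ≤ (i : ℕ∞) → Q.M q i = .N q ⊤ ∨ Q.M q i = .R := by
  obtain ⟨h2, hq, hd, hθ, -⟩ := id h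
  have hper : conPer (P.θ q) = (2 * d : ℕ) := by rw [hθ, conPer_natCon (by omega)]
  constructor
  · intro hsub
    have hr : ∀ π : Equiv.Perm (Fin q), (diag π : Partn n).rank = q := diag_rank hq
    have hmem := fun π hπ => hsub (h.mem_cgx (π := π) hπ)
    obtain ⟨τ, hτ⟩ := exists_notMem_alternatingGroup h2
    have hrel := rel_of_mem_cg ((hr _).trans (hr _).symm) (hmem τ hτ)
    rw [hr] at hrel
    have hmin : conMin (Q.θ q) ≤ (m : ℕ∞) := conMin_le (by omega) hrel
    refine ⟨Set.subset_union_left.trans hsub, ?_, fun i hi => ?_⟩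
    · have hne : Q.θ q ≠ ⊥ := by
        intro h'
        rw [h', bot_con_iff] at hrel
        omega
      obtain ⟨m', d', hd', hθ'⟩ := exists_eq_natCon hne
      rw [hper, hθ', conPer_natCon hd']
      rw [hθ'] at hrel
      rcases hrel with hrel | ⟨-, -, hrel⟩
      · omega
      · obtain ⟨k, hk⟩ := (Nat.modEq_iff_dvd' (Nat.le_add_right m d)).1 hrel
        rw [Nat.add_sub_cancel_left] at hk
        exact ⟨k, by rw [hk]; push_cast; ring⟩
    · rw [M_eq_of_conMin_le hq hi hmin]
      have hcond := fun π hπ => (mem_cg_iff.1 (hmem π hπ)).2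
      simp only [hr] at hcond
      rcases Q.row_ge_two h2 hq m with hs | ⟨H, hs, hH, -⟩ | hs
      · have h1 := hcond τ hτ
        rw [hs] at h1
        have h3 := diag_permDiff hq τ
        rw [← h1.2] at h3
        rw [h3.eq_one] at hτ
        exact absurd (Subgroup.one_mem _) hτ
      · refine Or.inl ?_
        suffices hT : H = ⊤ by rw [hs, hT]
        refine eq_top_of_odd_mem h2 fun π hπ => ?_
        have h1 := hcond π hπ
        rw [hs] at h1
        obtain ⟨-, -, -, π', hπ', hd⟩ := h1
        exact PermDiff.mem_of_mem hH (diag_permDiff hq π) hd hπ'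
      · exact Or.inr hs
  · rintro ⟨hsub, ⟨c, hc⟩, hM⟩ ⟨⟨i, α⟩, ⟨j, β⟩⟩ hp
    rcases mem_cgx_iff.1 hp with hp | ⟨m', d', hx, hr, hij, hnθ, hH, π, hπ, hpd⟩
    · exact hsub hp
    · obtain ⟨hq', rfl, rfl⟩ := h.unique hx
      subst hq'
      have hne : Q.θ α.rank ≠ ⊥ := by
        intro h'
        have := theta_le_of_cg_subset hsub hq (x := m) (y := m + 2 * d)
        rw [h', hθ] at this
        have : m = m + 2 * d := this (natCon_add_right le_rfl)
        omega
      obtain ⟨k, e, he, hk⟩ := exists_eq_natCon hne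
      have hkm : k ≤ m := by
        have := theta_le_of_cg_subset hsub hq
        rw [hk, hθ] at this
        exact (natCon_le_natCon (by omega) this).1
      -- The divisibility is one in `ℕ∞`; the quotient is finite because `2 * d` is, and then the
      -- factor 2 cancels.
      have hed : e ∣ d := by
        rw [hper, hk, conPer_natCon he] at hc
        have hct : c ≠ ⊤ := by
          rintro rfl
          rw [ENat.mul_top (by positivity)] at hc
          exact ENat.natCast_ne_top _ hc
        obtain ⟨c, rfl⟩ := ENat.ne_top_iff_exists.1 hct
        have hc' : 2 * d = 2 * e * c := by exact_mod_cast hc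
        exact ⟨c, by nlinarith⟩
      have hne' : i ≠ j := by
        rintro rfl
        exact hnθ ((P.θ _).refl _)
      rcases hij with hij | ⟨hi, hj, hij⟩
      · exact absurd hij hne'
      have hQij : Q.θ α.rank i j := by
        rw [hk]
        exact Or.inr ⟨by omega, by omega, hij.of_dvd hed⟩
      refine mem_cg_iff.2 ⟨by rw [hr]; exact M_eq_of_rel hq hQij, ?_⟩
      rcases hM i (conMin_le hne' hQij) with hs | hs <;> rw [hs]
      · exact ⟨rfl, hQij, hH, π, Subgroup.mem_top _, hpd⟩
      · trivial

/-- An odd multiple of `d` is an odd multiple of `e` when `d` is an odd multiple of `e`. -/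
theorem not_modEq_two_mul {d e k i j : ℕ} (hk : Odd k) (hd : d = k * e) (h : i ≡ j [MOD d])
    (h' : ¬ i ≡ j [MOD 2 * d]) : ¬ i ≡ j [MOD 2 * e] := by
  rcases Nat.eq_zero_or_pos e with rfl | he
  · subst hd
    exact h'
  rw [Nat.modEq_iff_dvd] at h h' ⊢
  rintro ⟨s, hs⟩
  obtain ⟨t, ht⟩ := h
  refine h' ?_
  have he' : (e : ℤ) ≠ 0 := by exact_mod_cast he.ne'
  have hst : (k : ℤ) * t = 2 * s := by
    apply mul_left_cancel₀ he'
    have := ht.symm.trans hs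
    rw [hd] at this
    push_cast at this
    linarith
  have hk' : ¬ (2 : ℤ) ∣ k := by
    intro h2
    have : 2 ∣ k := by exact_mod_cast h2
    exact (Nat.not_even_iff_odd.2 hk) (even_iff_two_dvd.2 this)
  obtain ⟨u, rfl⟩ := (Int.prime_two.dvd_or_dvd ⟨s, hst⟩).resolve_left hk'
  exact ⟨u, by rw [ht]; push_cast; ring⟩

/-- In a common exceptional row, an even ratio of periods would make `m` and `m + d` related in `Q`,
where `cg Q` admits only even permutations. An odd ratio sends odd pairs to odd pairs. -/
theorem ExcRow.cgx_subset_cgx_iff {q m d q' m' d' : ℕ} (h : P.ExcRow q m d)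
    (h' : Q.ExcRow q' m' d') :
    P.cgx ⊆ Q.cgx ↔ P.cg ⊆ Q.cg ∧
      (q = q' → ∃ k : ℕ, Odd k ∧ conPer (P.θ q) = k * conPer (Q.θ q)) := by
  obtain ⟨h2, hq, hd, hθ, hA, -⟩ := id h
  obtain ⟨h2', hq', hd', hθ', hA', -⟩ := id h'
  constructor
  · intro hsub
    have hcg : P.cg ⊆ Q.cg := cg_subset_cgx_iff.1 (Set.subset_union_left.trans hsub)
    refine ⟨hcg, ?_⟩
    rintro rfl
    have hle := theta_le_of_cg_subset hcg hq
    rw [hθ, hθ'] at hle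
    obtain ⟨hm, k, hk⟩ := natCon_le_natCon (by omega) hle
    have hk : d = d' * k := by nlinarith
    rw [hθ, hθ', conPer_natCon (by omega), conPer_natCon (by omega)]
    refine ⟨k, ?_, by rw [hk]; push_cast; ring⟩
    by_contra hodd
    obtain ⟨t, ht⟩ := even_iff_two_dvd.1 (Nat.not_odd_iff_even.1 hodd)
    obtain ⟨τ, hτ⟩ := exists_notMem_alternatingGroup h2
    have hr : ∀ π : Equiv.Perm (Fin q), (diag π : Partn n).rank = q := diag_rank hq
    rcases mem_cgx_iff.1 (hsub (h.mem_cgx hτ)) with h1 | ⟨-, -, -, -, -, hn, -⟩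
    · have h3 := (mem_cg_iff.1 h1).2
      rw [hr] at h3
      have h4 := diag_permDiff hq τ
      rcases h'.entry hm with hs | hs <;> rw [hs] at h3
      · rw [← h3.2] at h4
        rw [h4.eq_one] at hτ
        exact hτ (Subgroup.one_mem _)
      · obtain ⟨-, -, -, π', hπ', hpd⟩ := h3
        exact hτ (PermDiff.mem_of_mem inferInstance h4 hpd hπ')
    · rw [hr, hθ'] at hn
      refine hn (Or.inr ⟨hm, by omega, ?_⟩)
      refine (Nat.modEq_iff_dvd' (Nat.le_add_right m d)).2 ⟨t, ?_⟩
      rw [Nat.add_sub_cancel_left, hk, ht]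
      ring
  · rintro ⟨hcg, hk⟩
    rcases lt_trichotomy q q' with hlt | rfl | hlt
    -- The `N`-symbol in row `q'` of `Q` forces `R` in row `q`, which absorbs all odd pairs of `P`
    -- into `cg Q`.
    · have hR := M_eq_R_of_lt h2 hlt hq' (hA' (by omega))
      obtain ⟨k, hk, hkm⟩ := exists_natCon_one hq (Or.inr (Or.inr hR))
      refine Set.Subset.trans (h.cgx_subset_cg_iff.2 ⟨hcg, ?_, fun i hi => Or.inr ?_⟩)
        Set.subset_union_left
      · rw [hk, hθ, conPer_natCon le_rfl, conPer_natCon (by omega)]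
        exact ⟨d, by push_cast; ring⟩
      · rw [← hR]
        refine M_eq_of_conMin_le hq hi ?_
        rw [hk, conMin_natCon le_rfl]
        exact_mod_cast hkm
    · obtain ⟨k, hodd, hk⟩ := hk rfl
      have hle := theta_le_of_cg_subset hcg hq
      rw [hθ, hθ'] at hle
      obtain ⟨hm, -⟩ := natCon_le_natCon (by omega) hle
      rw [hθ, hθ', conPer_natCon (by omega), conPer_natCon (by omega)] at hk
      have hk' : 2 * d = k * (2 * d') := by exact_mod_cast hk
      have hk' : d = k * d' := by nlinarith
      rintro ⟨⟨i, α⟩, ⟨j, β⟩⟩ hp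
      rcases mem_cgx_iff.1 hp with hp | ⟨m₁, d₁, hx, hr, hij, hn, hH⟩
      · exact Or.inl (hcg hp)
      · obtain ⟨hq, rfl, rfl⟩ := h.unique hx
        subst hq
        refine mem_cgx_iff.2 (Or.inr ⟨m', d', h', hr, ?_, ?_, hH⟩)
        · rcases hij with rfl | ⟨hi, hj, hij⟩
          · exact (natCon m' d').refl _
          · exact Or.inr ⟨by omega, by omega, hij.of_dvd ⟨k, by rw [hk', mul_comm]⟩⟩
        · rw [hθ] at hn
          rw [hθ']
          rcases hij with rfl | ⟨hi, hj, hij⟩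
          · exact absurd ((natCon _ _).refl _) hn
          · rintro (rfl | ⟨-, -, h3⟩)
            · exact hn ((natCon _ _).refl _)
            · exact not_modEq_two_mul hodd hk' hij (fun h4 => hn (Or.inr ⟨hi, hj, h4⟩)) h3
    -- This order cannot occur: `P` has an `R` in row `q'`, hence so has `Q`, in its own exceptional
    -- row.
    · have hR := M_eq_R_of_lt h2' hlt hq (hA (by omega))
      have := high_row_lec hcg h2' hq' m
      rw [hR] at this
      have hR' : Q.M q' m = .R := by
        generalize Q.M q' m = s at this
        cases this <;> rfl
      exact absurd hR' (h'.ne_R m)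

end CPair

theorem theorem6p3 (n : ℕ) (hn : 1 ≤ n) (P₁ P₂ : CPair n) :
    -- (i)
    ((P₁.Compares P₂ → P₁.cg ⊆ P₂.cg) ∧
      ((n = 1 → P₁.Reduced ∧ P₂.Reduced) → P₁.cg ⊆ P₂.cg → P₁.Compares P₂)) ∧
    -- (ii)
    (∀ q, P₂.IsExceptional q → (P₁.cg ⊆ P₂.cgx ↔ P₁.cg ⊆ P₂.cg)) ∧
    -- (iii)
    (∀ q, P₁.IsExceptional q →
      (P₁.cgx ⊆ P₂.cg ↔
        P₁.cg ⊆ P₂.cg ∧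
        2 * conPer (P₂.θ q) ∣ conPer (P₁.θ q) ∧
        ∀ i : ℕ, conMin (P₂.θ q) ≤ (i : ℕ∞) → P₂.M q i = .N q ⊤ ∨ P₂.M q i = .R)) ∧
    -- (iv)
    (∀ q₁ q₂, P₁.IsExceptional q₁ → P₂.IsExceptional q₂ →
      (P₁.cgx ⊆ P₂.cgx ↔
        P₁.cg ⊆ P₂.cg ∧
        (q₁ = q₂ → ∃ k : ℕ, Odd k ∧ conPer (P₁.θ q₁) = k * conPer (P₂.θ q₁)))) := by
  refine ⟨⟨CPair.cg_subset_of_compares hn, fun hred h => CPair.compares_of_cg_subset hn hred h⟩,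
    fun _ _ => CPair.cg_subset_cgx_iff, ?_, ?_⟩
  · rintro q ⟨m, d, h⟩
    exact h.cgx_subset_cg_iff
  · rintro q₁ q₂ ⟨m₁, d₁, h₁⟩ ⟨m₂, d₂, h₂⟩
    exact h₁.cgx_subset_cgx_iff h₂
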